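/- Let $k$ be a number field of degree $n=[k:\mathbb{Q}]$ with ring of integers $O_k$, let $B$ be a finite-dimensional central division algebra over $k$ with $\dim_k B=d^2$, and let $\mathcal{D}\subset B$ be an $O_k$-order (a subring containing $O_k$, finitely generated over $O_k$ and spanning $B$ over $k$). For a place $v$ of $k$ put $B_v=k_v\otimes_k B$, and for $x\in B_v$ let $\mathrm{Norm}_v(x)=N_{k_v/\mathbb{Q}_{p(v)}}(\det(x\curvearrowright B_v))$, where $\mathbb{Q}_{p(v)}$ is the completion of $\mathbb{Q}$ at the place below $v$ ($\mathbb{R}$ if $v$ is archimedean) and $x\curvearrowright B_v$ is the $k_v$-linear map given by left multiplication by $x$; $|\cdot|$ denotes the usual absolute value on $\mathbb{Q}_{p(v)}$. For finite $v$ let $\mathcal{D}_v\subset B_v$ be the completion of $\mathcal{D}$. Let $B_{\mathbb{R}}=\prod_{v\mid\infty}B_v$, and let $T:B_{\mathbb{R}}\to\mathbb{R}$ be the sum over $v\mid\infty$ of $\mathrm{Tr}_{k_v/\mathbb{R}}$ of the reduced trace of $B_v$ over $k_v$. Let $d_{\mathcal{D}}=|\det(T(\omega_i\omega_j))|^{1/2}$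 for a $\mathbb{Z}$-basis $(\omega_i)$ of $\mathcal{D}$, and let $\mathrm{Vol}$ be the additive Tamagawa measure on $B_{\mathbb{R}}$, that is, the Haar measure giving the parallelepiped spanned by any $\mathbb{R}$-basis $(e_i)$ the volume $|\det(T(e_ie_j))|^{1/2}$; thus $\mathrm{Vol}(B_{\mathbb{R}}/\mathcal{D})=d_{\mathcal{D}}$. Let $S$ be a finite set of places of $k$ containing all archimedean places, and let $S_f$ be its set of finite places. Let $B_S^*=\prod_{v\mid\infty}B_v^*\times\prod_{v\in S_f}B_v^*$ and $$G_S=\Big\{(x,\beta)\in B_S^* : \prod_{v\mid\infty}|\mathrm{Norm}_v(x_v)|=\Big(\prod_{v\in S_f}|\mathrm{Norm}_v(\beta_v)|\Big)^{-1}\Big\}.$$ Let $\Gamma_S$ be the group of units of $\mathcal{D}_S=O_{k,S}\otimes_{O_k}\mathcal{D}\subset B$, where $O_{k,S}$ is the ring of $S$-integers of $k$; embed $\Gamma_S$ diagonally in $B_S^*$. For $\beta\in\prod_{v\in S_f}B_v^*$ let $\beta\mathcal{D}=B\cap\prod_{v\nmid\infty}\beta_v\mathcal{D}_v$, where $\beta_v=1$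 for $v\notin S$. Let $X\subset B_{\mathbb{R}}$ be compact, convex and symmetric ($-X=X$) with $\mathrm{Vol}(X)\ge 2^{\dim_{\mathbb{Q}}B}\,d_{\mathcal{D}}$, and let $m_X\ge 0$ be a real number such that $|\mathrm{Norm}_v(y_v)|\le m_X^{[k_v:\mathbb{R}]/n}$ for every $y=(y_v)_v\in X$ and every archimedean place $v$. Suppose that $S$ contains every finite place $v$ of $k$ with $\mathrm{Norm}(v)^d\le m_X$, where $\mathrm{Norm}(v)$ is the cardinality of the residue field of $v$. Then $$F_X=\{(x,\beta)\in G_S : x\in X,\ \beta\mathcal{D}\subseteq\mathcal{D},\ [\mathcal{D}:\beta\mathcal{D}]\le m_X\}$$ is compact and $\Gamma_S F_X=G_S$. -/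

import Mathlib

open NumberField IsDedekindDomain TensorProduct Module

open scoped Pointwise

noncomputable section

namespace DivAlg

section RealStructure

variable {k : Type*} [Field k]

/-- The canonical (unique continuous) ring homomorphism `ℝ → k_v` for an archimedean place `v`,
obtained from the identification of `k_v` with `ℝ` or `ℂ`. -/
def realToCompletion (v : InfinitePlace k) : ℝ →+* v.Completion :=
  open scoped Classical in
  if h : v.IsReal then
    (InfinitePlace.Completion.ringEquivRealOfIsReal h).symm.toRingHom
  else
    (InfinitePlace.Completion.ringEquivComplexOfIsComplex
      (InfinitePlace.not_isReal_iff_isComplex.mp h)).symm.toRingHom.comp Complex.ofRealHom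

instance instAlgebraRealCompletion (v : InfinitePlace k) : Algebra ℝ v.Completion :=
  (realToCompletion v).toAlgebra

/-- `k_v` is finite-dimensional over `ℝ` for every archimedean place `v`. -/
theorem finite_completion (v : InfinitePlace k) : Module.Finite ℝ v.Completion := by
  by_cases h : v.IsReal
  · have hs : Function.Surjective (Algebra.linearMap ℝ v.Completion) := by
      intro y
      refine ⟨InfinitePlace.Completion.ringEquivRealOfIsReal h y, ?_⟩
      change realToCompletion v _ = y
      rw [realToCompletion, dif_pos h]
      exact (InfinitePlace.Completion.ringEquivRealOfIsReal h).symm_apply_apply y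
    exact Module.Finite.of_surjective _ hs
  · let e := InfinitePlace.Completion.ringEquivComplexOfIsComplex
      (InfinitePlace.not_isReal_iff_isComplex.mp h)
    let f : ℂ →ₗ[ℝ] v.Completion :=
      { toFun := fun z => e.symm z
        map_add' := fun a b => map_add e.symm a b
        map_smul' := fun r z => by
          rw [Algebra.smul_def, Algebra.smul_def, map_mul]
          congr 1
          change _ = realToCompletion v r
          rw [realToCompletion, dif_neg h]
          rfl }
    exact Module.Finite.of_surjective f e.symm.surjective

instance instFiniteRealCompletion (v : InfinitePlace k) : Module.Finite ℝ v.Completion :=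
  finite_completion v

instance instSMulCommClassCompletion (v : InfinitePlace k) : SMulCommClass k ℝ v.Completion where
  smul_comm a r x := by
    rw [Algebra.smul_def, Algebra.smul_def, Algebra.smul_def, Algebra.smul_def, mul_left_comm]

end RealStructure

section Completions

variable {k : Type*} [Field k] [NumberField k] (B : Type*) [DivisionRing B] [Algebra k B]

/-- `B_v = k_v ⊗_k B` for an archimedean place `v` of `k`. -/
abbrev AtInf (v : InfinitePlace k) : Type _ := v.Completion ⊗[k] B

/-- `B_v = k_v ⊗_k B` for a finite place `v` of `k`. -/
abbrev AtFin (v : HeightOneSpectrum (𝓞 k)) : Type _ := v.adicCompletion k ⊗[k] B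

/-- `B_v` carries its natural topology as a finite-dimensional vector space over `k_v`. -/
instance instTopologicalSpaceAtInf (v : InfinitePlace k) : TopologicalSpace (AtInf B v) :=
  moduleTopology v.Completion (AtInf B v)

instance instTopologicalSpaceAtFin (v : HeightOneSpectrum (𝓞 k)) : TopologicalSpace (AtFin B v) :=
  moduleTopology (v.adicCompletion k) (AtFin B v)

instance instIsScalarTowerAtInf (v : InfinitePlace k) :
    IsScalarTower ℝ v.Completion (AtInf B v) where
  smul_assoc r a x := by
    induction x using TensorProduct.induction_on with
    | zero => simp
    | add x y hx hy => rw [smul_add, hx, hy, smul_add, smul_add]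
    | tmul b y => rw [TensorProduct.smul_tmul', TensorProduct.smul_tmul',
        TensorProduct.smul_tmul', smul_assoc]

instance instFiniteAtInf [FiniteDimensional k B] (v : InfinitePlace k) :
    Module.Finite ℝ (AtInf B v) :=
  Module.Finite.trans v.Completion (AtInf B v)

variable (k) in
/-- `B_ℝ = ∏_{v ∣ ∞} B_v`, a real vector space with the product topology. -/
abbrev BR : Type _ := (v : InfinitePlace k) → AtInf B v

variable {B}

/-- `|Norm_v(x)|` for `v` archimedean, where `Norm_v(x) = N_{k_v/ℝ}(det (x ↷ B_v))`.  Here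
`Algebra.norm` is the determinant of left multiplication, and `|N_{k_v/ℝ}(a)| = ‖a‖ ^ [k_v : ℝ]`. -/
def absNormInf (v : InfinitePlace k) (x : AtInf B v) : ℝ :=
  ‖Algebra.norm v.Completion x‖ ^ v.mult

/-- `|Norm_v(x)|` for `v` finite, where `Norm_v(x) = N_{k_v/ℚ_p}(det (x ↷ B_v))`.  Here
`Algebra.norm` is the determinant of left multiplication, and `|N_{k_v/ℚ_p}(a)|_p` is the
normalized absolute value of `a` (a uniformizer has absolute value `Norm(v)⁻¹`), which is Mathlib's
norm on `v.adicCompletion k`. -/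
def absNormFin (v : HeightOneSpectrum (𝓞 k)) (x : AtFin B v) : ℝ :=
  ‖Algebra.norm (v.adicCompletion k) x‖

/-- The trace `T : B_ℝ → ℝ`, the sum over `v ∣ ∞` of `Tr_{k_v/ℝ}` of the reduced trace of `B_v`
over `k_v`.  For a central simple algebra of degree `d` in characteristic zero the reduced trace
of `x` is `d⁻¹` times the trace of left multiplication by `x`. -/
def traceR (d : ℕ) (x : BR k B) : ℝ :=
  ∑ v : InfinitePlace k, Algebra.trace ℝ v.Completion
    ((d : v.Completion)⁻¹ *
      LinearMap.trace v.Completion (AtInf B v) (LinearMap.mulLeft v.Completion (x v)))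

/-- `|det (T(bᵢ bⱼ))| ^ (1/2)` for a finite family `b` in `B_ℝ`. -/
def rootGram (d : ℕ) {ι : Type*} [Fintype ι] [DecidableEq ι] (b : ι → BR k B) : ℝ :=
  Real.sqrt |(Matrix.of fun i j => traceR d (b i * b j)).det|

/-- The additive Tamagawa measure on `B_ℝ`, i.e. the Haar measure self-dual for the pairing
`T(xy)`: for an `ℝ`-basis `b` of `B_ℝ`, it is Lebesgue measure in the coordinates of `b` times
`|det (T(bᵢ bⱼ))| ^ (1/2)`.  This does not depend on `b`. -/
def vol [FiniteDimensional k B] (d : ℕ) (X : Set (BR k B)) : ENNReal :=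
  ENNReal.ofReal (rootGram d (finBasis ℝ (BR k B))) *
    MeasureTheory.volume
      {c : Fin (finrank ℝ (BR k B)) → ℝ | (finBasis ℝ (BR k B)).equivFun.symm c ∈ X}

/-- The diagonal embedding `B → B_ℝ`. -/
def toBR (x : B) : BR k B := fun _ => 1 ⊗ₜ[k] x

end Completions

section Orders

variable {k : Type*} [Field k] [NumberField k] {B : Type*} [DivisionRing B] [Algebra k B]

/-- An `O_k`-order in `B`: a subring containing the image of `O_k`, finitely generated as an
`O_k`-module, and spanning `B` over `k`. -/
structure IsOrder (D : Subalgebra (𝓞 k) B) : Prop where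
  fg : (Subalgebra.toSubmodule D).FG
  span_eq_top : Submodule.span k (D : Set B) = ⊤

/-- The discriminant `d_D = |det (T(ωᵢ ωⱼ))| ^ (1/2)`, the covolume of `D` in `B_ℝ`, computed on a
`ℤ`-basis `ω` of `D`. -/
def discr (d : ℕ) {D : Subalgebra (𝓞 k) B} {ι : Type*} [Fintype ι] [DecidableEq ι]
    (ω : Basis ι ℤ D) : ℝ :=
  rootGram d fun i => (toBR (ω i : B) : BR k B)

/-- The completion `D_v` of `D` at a finite place: the `O_v`-span of `D` in `B_v`. -/
def localOrder (D : Subalgebra (𝓞 k) B) (v : HeightOneSpectrum (𝓞 k)) : AddSubgroup (AtFin B v) :=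
  AddSubgroup.closure {y | ∃ a ∈ v.adicCompletionIntegers k, ∃ x ∈ D, y = a ⊗ₜ[k] x}

/-- `α D = B ∩ ∏_v α_v D_v` for a family `α = (α_v)` of units of the `B_v`, `v` finite. -/
def mulOrder (D : Subalgebra (𝓞 k) B) (α : (v : HeightOneSpectrum (𝓞 k)) → (AtFin B v)ˣ) :
    AddSubgroup B :=
  ⨅ v, ((localOrder D v).map (AddMonoidHom.mulLeft (α v : AtFin B v))).comap
    (Algebra.TensorProduct.includeRight : B →ₐ[k] AtFin B v).toRingHom.toAddMonoidHom

/-- `D` as an additive subgroup of `B`. -/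
def orderAddSubgroup (D : Subalgebra (𝓞 k) B) : AddSubgroup B :=
  (Subalgebra.toSubmodule D).toAddSubgroup

/-- The `S`-order `D_S = O_{k,S} ⊗ D`, i.e. the `O_{k,S}`-subalgebra `O_{k,S} · D` of `B`. -/
def sOrder (S : Finset (HeightOneSpectrum (𝓞 k))) (D : Subalgebra (𝓞 k) B) :
    Subalgebra ((S : Set (HeightOneSpectrum (𝓞 k))).integer k) B :=
  Algebra.adjoin _ (D : Set B)

/-- The group `Γ_S` of `S`-units of `D`: the units of `D_S`. -/
def sUnits (S : Finset (HeightOneSpectrum (𝓞 k))) (D : Subalgebra (𝓞 k) B) : Subgroup Bˣ :=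
  (sOrder S D).toSubmonoid.units

end Orders

section Groups

variable {k : Type*} [Field k] [NumberField k] (B : Type*) [DivisionRing B] [Algebra k B]

/-- `B_S^* = ∏_{v ∣ ∞} B_v^* × ∏_{v ∈ S_f} B_v^*`, where `S` is the set of finite places
in question (the archimedean places are always included). -/
abbrev BS (S : Finset (HeightOneSpectrum (𝓞 k))) : Type _ :=
  ((v : InfinitePlace k) → (AtInf B v)ˣ) × ((v : S) → (AtFin B v.1)ˣ)

/-- `G_S`, the subgroup of `B_S^*` cut out by `|Norm_∞(x)| = |Norm_f(β)|⁻¹`. -/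
def G (S : Finset (HeightOneSpectrum (𝓞 k))) : Subgroup (BS B S) where
  carrier := {g | ∏ v, absNormInf v (g.1 v : AtInf B v)
    = (∏ v, absNormFin v.1 (g.2 v : AtFin B v.1))⁻¹}
  one_mem' := by simp [absNormInf, absNormFin]
  mul_mem' := by
    intro a b ha hb
    simp only [Set.mem_ofPred_eq, absNormInf, absNormFin] at ha hb ⊢
    simp only [Prod.fst_mul, Prod.snd_mul, Pi.mul_apply, Units.val_mul, map_mul, norm_mul,
      mul_pow, Finset.prod_mul_distrib, mul_inv, ha, hb]
  inv_mem' := by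
    intro a ha
    simp only [Set.mem_ofPred_eq, absNormInf, absNormFin] at ha ⊢
    simp only [Prod.fst_inv, Prod.snd_inv, Pi.inv_apply, map_units_inv, norm_inv, inv_pow,
      Finset.prod_inv_distrib, ha]

variable {B}

/-- The diagonal embedding `B^* → B_S^*`. -/
def diag (S : Finset (HeightOneSpectrum (𝓞 k))) : Bˣ →* BS B S :=
  MonoidHom.prod
    (MonoidHom.pi fun v => Units.map
      (Algebra.TensorProduct.includeRight : B →ₐ[k] AtInf B v).toRingHom.toMonoidHom)
    (MonoidHom.pi fun v => Units.map
      (Algebra.TensorProduct.includeRight : B →ₐ[k] AtFin B v.1).toRingHom.toMonoidHom)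

open scoped Classical in
/-- The inclusion of `∏_{v ∈ S_f} B_v^*` in `B_f^*`: the components outside `S` are `1`. -/
def extendOne {S : Finset (HeightOneSpectrum (𝓞 k))} (β : (v : S) → (AtFin B v.1)ˣ)
    (v : HeightOneSpectrum (𝓞 k)) : (AtFin B v)ˣ :=
  if h : v ∈ S then β ⟨v, h⟩ else 1

/-- `F_X = {(x, β) ∈ G_S : x ∈ X, β D ⊆ D, [D : β D] ≤ m}`. -/
def F (S : Finset (HeightOneSpectrum (𝓞 k))) (D : Subalgebra (𝓞 k) B) (X : Set (BR k B)) (m : ℝ) :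
    Set (BS B S) :=
  {g | g ∈ G B S ∧ (fun v => (g.1 v : AtInf B v)) ∈ X ∧
    mulOrder D (extendOne g.2) ≤ orderAddSubgroup D ∧
    ((mulOrder D (extendOne g.2)).relIndex (orderAddSubgroup D) : ℝ) ≤ m}

end Groups

end DivAlg

end

/-! The equality `Γ_S F_X = G_S` is Minkowski's theorem followed by the product formula. Let `g =
(x, β)` be in `G_S` and let `Λ ⊂ B` be the lattice of all `δ` with `δ β_v` in `D_v` for `v ∈ S_f`
and `δ` in `D_v` at the other finite places, that is, `Λ = D β⁻¹`. The covolume of `Λ x` in `B_ℝ` is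
`d_D` times the product of the `|Norm_v(β_v)|` and of the `|Norm_v(x_v)|`, hence exactly `d_D` by
the equation of `G_S`. Since `Vol(X) ≥ 2 ^ dim B * d_D`, some nonzero `δ ∈ Λ` satisfies `δ x ∈ X`.

This `δ` is an `S`-unit. The norms of `δ x` and `δ β` bound the product of `|Norm_v(δ)|` over `S`
and the archimedean places by `m`, so by the product formula the product over the other places is at
least `1 / m`. There `δ` is integral and `Norm_v(δ)` is a `d`-th power, that of the reduced norm; so
`|Norm_v(δ)|` is `1` or at most `Norm(v)^(-d)`, and the latter is less than `1 / m` for `v ∉ S`.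
Hence all these norms are `1`, `δ` is invertible in every `D_v` with `v ∉ S`, and `δ g` lies in
`F_X` (`exists_sublattice`, `exists_mul_mem_of_relIndex_le`, `mem_sUnits_of_prod_le`).

Both this and compactness use a simpler description of `F_X` (`mem_F_iff`): `β D ⊆ D` means that
every `β_v` lies in `D_v`, and the bound on the index then follows from the equation of `G_S`. On
`F_X` the finitely many factors `|Norm_v|` are bounded above and have product `1`, so they are
bounded below; thus `F_X` is closed in a product of compact sets of units (`isCompact_F`).

Passing to a splitting field gives two algebraic facts: left and right multiplications have equal
determinants, which is needed because `β` and `x` act on the right of the lattice, and the norm is a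
`d`-th power. -/

noncomputable section
namespace DivAlg

/-! ### Splitting the algebra over an algebraic closure; norms and reduced norms. -/

section Splitting

/-- The base change of a central division algebra to a field extension is simple. -/
theorem isSimpleRing_tensorProduct (k Ω B : Type*) [Field k] [Field Ω] [Algebra k Ω]
    [DivisionRing B] [Algebra k B] [Algebra.IsCentral k B] : IsSimpleRing (Ω ⊗[k] B) := by
  classical
  let c := Basis.ofVectorSpace k Ω
  let E := TensorProduct.equivFinsuppOfBasisLeft (N := B) c
  have hEl : ∀ (b : B) (z : Ω ⊗[k] B) i, E ((1 ⊗ₜ b) * z) i = b * E z i := by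
    intro b z i
    induction z using TensorProduct.induction_on with
    | zero => simp
    | add x y hx hy => simp only [mul_add, map_add, Finsupp.add_apply, hx, hy]
    | tmul a y =>
      simp only [Algebra.TensorProduct.tmul_mul_tmul, one_mul, E,
        TensorProduct.equivFinsuppOfBasisLeft_apply_tmul_apply, Algebra.mul_smul_comm]
  have hEr : ∀ (b : B) (z : Ω ⊗[k] B) i, E (z * (1 ⊗ₜ b)) i = E z i * b := by
    intro b z i
    induction z using TensorProduct.induction_on with
    | zero => simp
    | add x y hx hy => simp only [add_mul, map_add, Finsupp.add_apply, hx, hy]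
    | tmul a y =>
      simp only [Algebra.TensorProduct.tmul_mul_tmul, mul_one, E,
        TensorProduct.equivFinsuppOfBasisLeft_apply_tmul_apply, Algebra.smul_mul_assoc]
  refine ⟨{ eq_bot_or_eq_top := fun I => ?_, exists_pair_ne := ?_ }⟩
  · refine ⟨⊥, ⊤, fun h => ?_⟩
    have h1 : (1 : Ω ⊗[k] B) ∈ (⊥ : TwoSidedIdeal (Ω ⊗[k] B)) := h ▸ TwoSidedIdeal.mem_top _
    exact one_ne_zero ((TwoSidedIdeal.mem_bot _).mp h1)
  by_cases hI : I = ⊥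
  · exact Or.inl hI
  right
  -- Shortest-element argument: take a nonzero element of `I` with the fewest coordinates in a
  -- `k`-basis of `Ω` and scale one coordinate to `1`. Its commutator with `1 ⊗ b` is shorter, hence
  -- zero; so the coordinates are central, the element is `ω ⊗ 1`, and it is invertible.
  let s : Set (Ω ⊗[k] B) := {z | z ∈ I ∧ z ≠ 0}
  have hs : s.Nonempty := by
    by_contra hne
    apply hI
    refine TwoSidedIdeal.ext fun x => ?_
    rw [TwoSidedIdeal.mem_bot]
    refine ⟨fun hx => ?_, fun hx => hx ▸ I.zero_mem⟩
    by_contra hx0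
    exact hne ⟨x, hx, hx0⟩
  let z := Function.argminOn (fun z => (E z).support.card) s hs
  have hz : z ∈ s := Function.argminOn_mem _ _ _
  have hmin : ∀ w ∈ s, (E z).support.card ≤ (E w).support.card := fun w hw =>
    Function.argminOn_le (fun z => (E z).support.card) s hw
  have hEz : E z ≠ 0 := fun h => hz.2 (E.map_eq_zero_iff.mp h)
  obtain ⟨i₀, hi₀⟩ := Finsupp.support_nonempty_iff.mpr hEz
  rw [Finsupp.mem_support_iff] at hi₀
  let z' := (1 ⊗ₜ (E z i₀)⁻¹) * z
  have hz'I : z' ∈ I := I.mul_mem_left _ _ hz.1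
  have hz'1 : E z' i₀ = 1 := by rw [hEl, inv_mul_cancel₀ hi₀]
  have hcomm : ∀ b i, b * E z' i = E z' i * b := by
    intro b i
    let w := (1 ⊗ₜ b) * z' - z' * (1 ⊗ₜ b)
    have hw : ∀ i, E w i = b * E z' i - E z' i * b := fun i => by
      simp only [w, map_sub, Finsupp.sub_apply, hEl b z', hEr b z']
    have hwI : w ∈ I := I.sub_mem (I.mul_mem_left _ _ hz'I) (I.mul_mem_right _ _ hz'I)
    have hw0 : w = 0 := by
      by_contra hne
      have h1 := hmin w ⟨hwI, hne⟩
      have h2 : (E w).support ⊆ (E z).support.erase i₀ := by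
        intro j hj
        rw [Finsupp.mem_support_iff, hw] at hj
        rw [Finset.mem_erase, Finsupp.mem_support_iff]
        refine ⟨fun hji => hj (by rw [hji, hz'1]; simp), fun hj0 => hj ?_⟩
        rw [hEl, hj0]; simp
      have h3 := Finset.card_le_card h2
      have h4 := Finset.card_erase_lt_of_mem (Finsupp.mem_support_iff.mpr hi₀)
      omega
    have := hw i
    rw [hw0, map_zero, Finsupp.zero_apply] at this
    exact (sub_eq_zero.mp this.symm)
  have hcent : ∀ i, ∃ a : k, E z' i = algebraMap k B a := fun i => by
    rw [← Algebra.IsCentral.mem_center_iff, Subalgebra.mem_center_iff]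
    exact fun b => hcomm b i
  choose a ha using hcent
  have hz'eq : z' = ((E z').sum fun i _ => a i • c i) ⊗ₜ 1 := by
    conv_lhs => rw [← E.symm_apply_apply z']
    rw [TensorProduct.equivFinsuppOfBasisLeft_symm_apply, Finsupp.sum, Finsupp.sum,
      TensorProduct.sum_tmul]
    refine Finset.sum_congr rfl fun i _ => ?_
    rw [ha, Algebra.algebraMap_eq_smul_one, TensorProduct.tmul_smul, TensorProduct.smul_tmul']
  have hz'0 : z' ≠ 0 := fun h => by
    rw [h, map_zero, Finsupp.zero_apply] at hz'1
    exact zero_ne_one hz'1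
  set ω := (E z').sum fun i _ => a i • c i
  have hω : ω ≠ 0 := fun h => hz'0 (by rw [hz'eq, h, TensorProduct.zero_tmul])
  rw [← TwoSidedIdeal.one_mem_iff]
  have h1 : (1 : Ω ⊗[k] B) = (ω⁻¹ ⊗ₜ 1) * z' := by
    rw [hz'eq, Algebra.TensorProduct.tmul_mul_tmul, inv_mul_cancel₀ hω, one_mul]
    rfl
  rw [h1]
  exact I.mul_mem_left _ _ hz'I

theorem exists_algEquiv_matrix (k Ω B : Type*) [Field k] [Field Ω] [IsAlgClosed Ω] [Algebra k Ω]
    [DivisionRing B] [Algebra k B] [Algebra.IsCentral k B] [FiniteDimensional k B]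
    {d : ℕ} (hd : finrank k B = d ^ 2) :
    Nonempty (Ω ⊗[k] B ≃ₐ[Ω] Matrix (Fin d) (Fin d) Ω) := by
  have := isSimpleRing_tensorProduct k Ω B
  obtain ⟨n, _, ⟨e⟩⟩ := IsSimpleRing.exists_algEquiv_matrix_of_isAlgClosed Ω (Ω ⊗[k] B)
  have h := e.toLinearEquiv.finrank_eq
  rw [finrank_baseChange, Module.finrank_matrix, finrank_self, hd, Fintype.card_fin] at h
  obtain rfl : n = d := Nat.pow_left_injective (n := 2) (by norm_num) (by simp only; nlinarith)
  exact ⟨e⟩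

/-- Left multiplication acts on each column separately; transposing turns columns into the factors
of a product of copies of `n → Ω`. -/
theorem det_mulLeft_matrix {Ω : Type*} [Field Ω] {n : Type*} [Fintype n] [DecidableEq n]
    (M : Matrix n n Ω) :
    LinearMap.det (LinearMap.mulLeft Ω M) = M.det ^ Fintype.card n := by
  let T : Matrix n n Ω ≃ₗ[Ω] (n → n → Ω) := Matrix.transposeLinearEquiv n n Ω Ω
  have h : T.toLinearMap ∘ₗ LinearMap.mulLeft Ω M ∘ₗ T.symm.toLinearMap =
      LinearMap.pi (fun i => (Matrix.toLin' M).comp (LinearMap.proj i)) := by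
    refine LinearMap.ext fun x => ?_
    funext i j
    rfl
  rw [← LinearMap.det_conj _ T, h, LinearMap.det_pi]
  simp

theorem det_mulRight_matrix {Ω : Type*} [Field Ω] {n : Type*} [Fintype n] [DecidableEq n]
    (M : Matrix n n Ω) :
    LinearMap.det (LinearMap.mulRight Ω M) = M.det ^ Fintype.card n := by
  let T : Matrix n n Ω ≃ₗ[Ω] (n → n → Ω) := .refl Ω _
  have h : T.toLinearMap ∘ₗ LinearMap.mulRight Ω M ∘ₗ T.symm.toLinearMap =
      LinearMap.pi (fun i => (Matrix.vecMulLinear M).comp (LinearMap.proj i)) := by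
    refine LinearMap.ext fun x => ?_
    funext i j
    rfl
  rw [← LinearMap.det_conj _ T, h, LinearMap.det_pi]
  have h2 : Matrix.vecMulLinear M = Matrix.toLin' M.transpose := by
    refine LinearMap.ext fun x => ?_
    simp [Matrix.mulVec_transpose]
  simp [h2]

theorem det_mulLeft_algEquiv {K A A' : Type*} [Field K] [Ring A] [Algebra K A] [Ring A']
    [Algebra K A'] (e : A ≃ₐ[K] A') (x : A) :
    LinearMap.det (LinearMap.mulLeft K (e x)) = LinearMap.det (LinearMap.mulLeft K x) := by
  rw [← LinearMap.det_conj _ e.toLinearEquiv]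
  congr 1
  refine LinearMap.ext fun y => ?_
  simp

theorem det_mulRight_algEquiv {K A A' : Type*} [Field K] [Ring A] [Algebra K A] [Ring A']
    [Algebra K A'] (e : A ≃ₐ[K] A') (x : A) :
    LinearMap.det (LinearMap.mulRight K (e x)) = LinearMap.det (LinearMap.mulRight K x) := by
  rw [← LinearMap.det_conj _ e.toLinearEquiv]
  congr 1
  refine LinearMap.ext fun y => ?_
  simp

theorem norm_eq_det_mulLeft {K A : Type*} [Field K] [Ring A] [Algebra K A] (x : A) :
    Algebra.norm K x = LinearMap.det (LinearMap.mulLeft K x) :=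
  rfl

theorem baseChange_mulLeft {K A : Type*} [Field K] [Ring A] [Algebra K A] (L : Type*) [Field L]
    [Algebra K L] (x : A) :
    (LinearMap.mulLeft K x).baseChange L = LinearMap.mulLeft L ((1 : L) ⊗ₜ[K] x) := by
  ext; simp

theorem baseChange_mulRight {K A : Type*} [Field K] [Ring A] [Algebra K A] (L : Type*) [Field L]
    [Algebra K L] (x : A) :
    (LinearMap.mulRight K x).baseChange L = LinearMap.mulRight L ((1 : L) ⊗ₜ[K] x) := by
  ext; simp

/-- Base change in stages, for a possibly noncommutative algebra. -/
def cancelBaseChangeAlgEquiv (k K L B : Type*) [Field k] [Field K] [Field L] [Algebra k K]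
    [Algebra K L] [Algebra k L] [IsScalarTower k K L] [Ring B] [Algebra k B] :
    L ⊗[K] (K ⊗[k] B) ≃ₐ[L] L ⊗[k] B :=
  (Algebra.TensorProduct.algEquivOfLinearEquivTensorProduct
    (AlgebraTensorModule.cancelBaseChange k K L L B).symm
    (fun a₁ a₂ b₁ b₂ => by simp)
    (by simp [Algebra.TensorProduct.one_def])).symm

/-- Left and right multiplication by an element of a central simple algebra have the same
determinant. -/
theorem det_mulRight_eq_norm {k B : Type*} [Field k] [DivisionRing B] [Algebra k B]
    [Algebra.IsCentral k B] [FiniteDimensional k B] {d : ℕ} (hd : finrank k B = d ^ 2)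
    (K : Type*) [Field K] [Algebra k K] (x : K ⊗[k] B) :
    LinearMap.det (LinearMap.mulRight K x) = Algebra.norm K x := by
  -- After base change to an algebraic closure both determinants are the `d`-th power of the matrix
  -- determinant.
  obtain ⟨e⟩ := exists_algEquiv_matrix k (AlgebraicClosure K) B hd
  let f := (cancelBaseChangeAlgEquiv k K (AlgebraicClosure K) B).trans e
  apply FaithfulSMul.algebraMap_injective K (AlgebraicClosure K)
  rw [norm_eq_det_mulLeft, ← LinearMap.det_baseChange, ← LinearMap.det_baseChange,
    baseChange_mulRight, baseChange_mulLeft, ← det_mulRight_algEquiv f, ← det_mulLeft_algEquiv f,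
    det_mulRight_matrix, det_mulLeft_matrix]

theorem norm_one_tmul {k B : Type*} [Field k] [DivisionRing B] [Algebra k B]
    [FiniteDimensional k B] (K : Type*) [Field K] [Algebra k K] (x : B) :
    Algebra.norm K ((1 : K) ⊗ₜ[k] x) = algebraMap k K (Algebra.norm k x) := by
  rw [norm_eq_det_mulLeft, norm_eq_det_mulLeft, ← LinearMap.det_baseChange, baseChange_mulLeft]

/-- Evaluating at `t` reduces this to `det_mulLeft_matrix` for the matrix `t - M`; over an infinite
field the values determine the polynomial. -/
theorem charpoly_mulLeft_matrix {Ω : Type*} [Field Ω] [Infinite Ω] {n : Type*} [Fintype n]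
    [DecidableEq n] (M : Matrix n n Ω) :
    (LinearMap.mulLeft Ω M).charpoly = M.charpoly ^ Fintype.card n := by
  refine Polynomial.funext fun t => ?_
  rw [LinearMap.eval_charpoly, Polynomial.eval_pow, Matrix.eval_charpoly, ← det_mulLeft_matrix]
  congr 1
  refine LinearMap.ext fun y => ?_
  simp [sub_mul, ← Matrix.smul_eq_diagonal_mul]

theorem eq_of_monic_of_pow_eq {Ω : Type*} [Field Ω] {P Q : Polynomial Ω} (hP : P.Monic)
    (hQ : Q.Monic) {d : ℕ} (hd : d ≠ 0) (h : P ^ d = Q ^ d) : P = Q := by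
  apply Polynomial.eq_of_monic_of_associated hP hQ
  exact associated_of_dvd_dvd ((UniqueFactorizationMonoid.pow_dvd_pow_iff_dvd hd).mp h.dvd) ((UniqueFactorizationMonoid.pow_dvd_pow_iff_dvd hd).mp h.symm.dvd)

/-- The norm of an element of a central division algebra of degree `d` is a `d`-th power, namely
that of its reduced norm. -/
theorem exists_norm_eq_pow {k B : Type*} [Field k] [CharZero k] [DivisionRing B] [Algebra k B]
    [Algebra.IsCentral k B] [FiniteDimensional k B] {d : ℕ} (hd : finrank k B = d ^ 2) (x : B) :
    ∃ a : k, Algebra.norm k x = a ^ d := by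
  let Ω := AlgebraicClosure k
  have hd0 : d ≠ 0 := by
    rintro rfl
    exact (finrank_pos (R := k) (M := B)).ne' (by simpa using hd)
  obtain ⟨e⟩ := exists_algEquiv_matrix k Ω B hd
  let M := e (1 ⊗ₜ x)
  have hχ : (LinearMap.mulLeft k x).charpoly.map (algebraMap k Ω) = M.charpoly ^ d := by
    have h := charpoly_mulLeft_matrix M
    rw [Fintype.card_fin] at h
    rw [← LinearMap.charpoly_baseChange, baseChange_mulLeft, ← h,
      ← e.toLinearEquiv.symm.charpoly_conj]
    congr 1
    refine LinearMap.ext fun y => ?_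
    simp [M, LinearEquiv.conj_apply]
  -- The `d`-th power of `M.charpoly` has coefficients in `k`, and a monic `d`-th root is unique, so
  -- `M.charpoly` is Galois-invariant. Its constant term, the reduced norm up to sign, therefore
  -- lies in `k`.
  have hfix : ∀ σ : Ω ≃ₐ[k] Ω, σ (M.charpoly.coeff 0) = M.charpoly.coeff 0 := by
    intro σ
    have h1 : (M.charpoly.map (σ : Ω →+* Ω)) = M.charpoly := by
      refine eq_of_monic_of_pow_eq (M.charpoly_monic.map _) M.charpoly_monic hd0 ?_
      rw [← Polynomial.map_pow, ← hχ, Polynomial.map_map]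
      congr 1
      exact RingHom.ext fun a => σ.commutes a
    conv_rhs => rw [← h1]
    simp
  obtain ⟨a, ha⟩ := (InfiniteGalois.mem_range_algebraMap_iff_fixed _).mpr hfix
  refine ⟨(-1) ^ d * a, ?_⟩
  apply FaithfulSMul.algebraMap_injective k Ω
  rw [norm_eq_det_mulLeft, ← LinearMap.det_baseChange, baseChange_mulLeft, ← det_mulLeft_algEquiv e, det_mulLeft_matrix,
    Matrix.det_eq_sign_charpoly_coeff, map_pow, map_mul, ha]
  simp [M]

end Splitting

end DivAlg

noncomputable section
namespace DivAlg

/-! ### Approximation, discreteness and compactness in the completions at finite places. -/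

section LocalField

variable {k : Type*} [Field k] [NumberField k] (v : HeightOneSpectrum (𝓞 k))

theorem norm_le_one_iff_mem (x : v.adicCompletion k) :
    ‖x‖ ≤ 1 ↔ x ∈ v.adicCompletionIntegers k :=
  Valued.toNormedField.norm_le_one_iff

theorem norm_sub_le_max_norm (x y : v.adicCompletion k) : ‖x - y‖ ≤ max ‖x‖ ‖y‖ := by
  rw [sub_eq_add_neg, ← norm_neg y]
  exact IsUltrametricDist.norm_add_le_max _ _

theorem norm_algebraMap_eq_finitePlace (x : k) :
    ‖algebraMap k (v.adicCompletion k) x‖ = FinitePlace.mk v x :=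
  rfl

theorem norm_algebraMap_int_le_one (r : 𝓞 k) :
    ‖algebraMap k (v.adicCompletion k) (r : k)‖ ≤ 1 :=
  FinitePlace.norm_le_one k v r

theorem norm_isUnit_eq_one {a : v.adicCompletionIntegers k} (ha : IsUnit a) :
    ‖(a : v.adicCompletion k)‖ = 1 := by
  have h := HeightOneSpectrum.adicCompletionIntegers.isUnit_iff_valued_eq_one.mp ha
  rw [FinitePlace.norm_def, h]
  simp

theorem norm_eq_one_iff_isUnit {a : v.adicCompletionIntegers k} :
    ‖(a : v.adicCompletion k)‖ = 1 ↔ IsUnit a := by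
  refine ⟨fun h => ?_, norm_isUnit_eq_one v⟩
  rw [HeightOneSpectrum.adicCompletionIntegers.isUnit_iff_valued_eq_one]
  refine le_antisymm (Valued.toNormedField.norm_le_one_iff.mp h.le)
    (Valued.toNormedField.one_le_norm_iff.mp h.ge)

theorem valuation_le_one_iff_norm (x : k) :
    v.valuation k x ≤ 1 ↔ ‖algebraMap k (v.adicCompletion k) x‖ ≤ 1 := by
  rw [Valued.toNormedField.norm_le_one_iff]
  exact (congrArg (· ≤ 1) (v.valuedAdicCompletion_eq_valuation' x)).to_iff.symm

/-- Elements of the number field approximate elements of its completion. -/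
theorem exists_norm_sub_le (x : v.adicCompletion k) {ε : ℝ} (hε : 0 < ε) :
    ∃ y : k, ‖x - algebraMap k _ y‖ ≤ ε := by
  obtain ⟨y, hy⟩ := (HeightOneSpectrum.denseRange_algebraMap (K := k) v).exists_dist_lt x hε
  exact ⟨y, by rw [← dist_eq_norm]; exact hy.le⟩

/-- Algebraic integers approximate elements of the ring of integers of the completion. -/
theorem exists_int_norm_sub_le {x : v.adicCompletion k} (hx : ‖x‖ ≤ 1) {a : v.adicCompletion k}
    (ha : a ≠ 0) : ∃ r : 𝓞 k, ‖x - algebraMap k _ (r : k)‖ ≤ ‖a‖ := by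
  have hε : 0 < min ‖a‖ 1 := lt_min (norm_pos_iff.mpr ha) one_pos
  obtain ⟨y, hy⟩ := exists_norm_sub_le v x hε
  have hy1 : ‖algebraMap k (v.adicCompletion k) y‖ ≤ 1 := by
    have : algebraMap k (v.adicCompletion k) y = x - (x - algebraMap k _ y) := by ring
    rw [this]
    exact (norm_sub_le_max_norm v _ _).trans
      (max_le hx (hy.trans (min_le_right _ _)))
  have hva : Valued.v a ≠ 0 := (Valuation.ne_zero_iff _).mpr ha
  obtain ⟨r, hr⟩ := HeightOneSpectrum.exists_valuation_sub_lt_of_integer v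
    ((valuation_le_one_iff_norm v y).mpr hy1) (Units.mk0 _ hva)
  refine ⟨r, ?_⟩
  have : x - algebraMap k (v.adicCompletion k) (r : k) =
      (x - algebraMap k _ y) - (algebraMap k _ ((r : k) - y)) := by
    rw [map_sub]; ring
  rw [this]
  refine (norm_sub_le_max_norm v _ _).trans
    (max_le (hy.trans (min_le_left _ _)) ?_)
  rw [Valued.toNormedField.norm_le_iff]
  exact (v.valuedAdicCompletion_eq_valuation' _).le.trans hr.le

theorem exists_valued_eq_exp_neg {a : v.adicCompletion k} (ha : ‖a‖ ≤ 1) (ha0 : a ≠ 0) :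
    ∃ n : ℕ, Valued.v a = WithZero.exp (-(n : ℤ)) := by
  have hva : Valued.v a ≠ 0 := (Valuation.ne_zero_iff _).mpr ha0
  have h1 := Valued.toNormedField.norm_le_one_iff.mp ha
  rw [← WithZero.exp_log hva, ← WithZero.exp_zero, WithZero.exp_le_exp] at h1
  refine ⟨(WithZero.log (Valued.v a)).natAbs, ?_⟩
  rw [Int.natCast_natAbs, abs_of_nonpos h1, neg_neg, WithZero.exp_log hva]

theorem norm_of_valued_eq_exp_neg {a : v.adicCompletion k} {n : ℕ}
    (hn : Valued.v a = WithZero.exp (-(n : ℤ))) :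
    ‖a‖ = ((Ideal.absNorm v.asIdeal : ℝ) ^ n)⁻¹ := by
  rw [FinitePlace.norm_def, hn, WithZeroMulInt.toNNReal_neg_apply _ WithZero.exp_ne_zero]
  have : Multiplicative.toAdd (WithZero.unzero (WithZero.exp_ne_zero (a := -(n : ℤ)))) = -(n : ℤ) :=
    rfl
  rw [this]
  simp

/-- The norm on the completion is discretely valued. -/
theorem norm_eq_one_of_inv_absNorm_lt {a : v.adicCompletion k} (ha : ‖a‖ ≤ 1)
    (h : (Ideal.absNorm v.asIdeal : ℝ)⁻¹ < ‖a‖) : ‖a‖ = 1 := by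
  have hq : (1 : ℝ) < Ideal.absNorm v.asIdeal := by
    exact_mod_cast HeightOneSpectrum.one_lt_absNorm v
  have ha0 : a ≠ 0 := by
    rintro rfl
    rw [norm_zero] at h
    exact absurd h (by simp)
  obtain ⟨n, hn⟩ := exists_valued_eq_exp_neg v ha ha0
  rw [norm_of_valued_eq_exp_neg v hn] at h ⊢
  obtain rfl : n = 0 := by
    by_contra hn0
    refine absurd h (not_lt.mpr ?_)
    exact inv_anti₀ (by linarith) (le_self_pow₀ hq.le hn0)
  simp

/-- The index of a principal ideal of the ring of integers of the completion. -/
theorem index_span_singleton (a : v.adicCompletionIntegers k) (ha : a ≠ 0) :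
    ((Ideal.span {a}).toAddSubgroup.index : ℝ) = ‖(a : v.adicCompletion k)‖⁻¹ := by
  have ha0 : (a : v.adicCompletion k) ≠ 0 := by simpa using ha
  have ha1 : ‖(a : v.adicCompletion k)‖ ≤ 1 := (norm_le_one_iff_mem v _).mpr a.2
  obtain ⟨n, hn⟩ := exists_valued_eq_exp_neg v ha1 ha0
  have hmem : ∀ x : v.adicCompletionIntegers k,
      x ∈ Ideal.span {a} ↔ ‖(x : v.adicCompletion k)‖ ≤ ‖(a : v.adicCompletion k)‖ := by
    intro x
    rw [Ideal.mem_span_singleton]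
    constructor
    · rintro ⟨y, rfl⟩
      rw [MulMemClass.coe_mul, norm_mul]
      exact mul_le_of_le_one_right (norm_nonneg _) ((norm_le_one_iff_mem v _).mpr y.2)
    · intro h
      refine ⟨⟨(a : v.adicCompletion k)⁻¹ * x, ?_⟩, ?_⟩
      · rw [← norm_le_one_iff_mem, norm_mul, norm_inv, inv_mul_le_iff₀ (norm_pos_iff.mpr ha0),
          mul_one]
        exact h
      · ext
        simp [mul_inv_cancel_left₀ ha0]
  -- The quotient is counted globally: algebraic integers surject onto it by density, with kernel `𝔭
  -- ^ n` where `n` is the valuation of `a`.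
  let φ : 𝓞 k →+* (v.adicCompletionIntegers k ⧸ Ideal.span {a}) :=
    (Ideal.Quotient.mk _).comp (algebraMap (𝓞 k) (v.adicCompletionIntegers k))
  have hφ : Function.Surjective φ := by
    intro x
    obtain ⟨x, rfl⟩ := Ideal.Quotient.mk_surjective x
    obtain ⟨r, hr⟩ := exists_int_norm_sub_le v ((norm_le_one_iff_mem v _).mpr x.2) ha0
    refine ⟨r, ?_⟩
    rw [RingHom.comp_apply, eq_comm, Ideal.Quotient.mk_eq_mk_iff_sub_mem, hmem]
    exact hr
  have hker : RingHom.ker φ = v.asIdeal ^ n := by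
    ext r
    rw [RingHom.mem_ker, RingHom.comp_apply, Ideal.Quotient.eq_zero_iff_mem, hmem,
      Valued.toNormedField.norm_le_iff, hn, ← HeightOneSpectrum.intValuation_le_pow_iff_mem,
      ← HeightOneSpectrum.valuation_of_algebraMap (K := k)]
    exact (congrArg (· ≤ _) (v.valuedAdicCompletion_eq_valuation' (r : k))).to_iff
  have h1 : (Ideal.span {a}).toAddSubgroup.index = Ideal.absNorm (v.asIdeal ^ n) := by
    rw [← hker, Ideal.absNorm_apply, Submodule.cardQuot_apply]
    exact Nat.card_congr (RingHom.quotientKerEquivOfSurjective hφ).symm.toEquiv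
  rw [h1, norm_of_valued_eq_exp_neg v hn, inv_inv, map_pow, Nat.cast_pow]

/-- Every nonzero integral ideal of the number field becomes open: the ring of integers of the
completion is compact. -/
theorem isCompact_integers : IsCompact {x : v.adicCompletion k | ‖x‖ ≤ 1} := by
  have hfin : Finite (IsLocalRing.ResidueField (v.adicCompletionIntegers k)) := by
    -- The index formula for a uniformizer shows that the residue field is finite.
    obtain ⟨ϖ, hϖ⟩ := IsDiscreteValuationRing.exists_irreducible (v.adicCompletionIntegers k)
    have h := index_span_singleton v ϖ hϖ.ne_zero
    have h0 : (Ideal.span {ϖ}).toAddSubgroup.index ≠ 0 := by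
      intro h0
      rw [h0, Nat.cast_zero, eq_comm, inv_eq_zero, norm_eq_zero] at h
      exact hϖ.ne_zero (by simpa using h)
    have : Finite (v.adicCompletionIntegers k ⧸ Ideal.span {ϖ}) :=
      Nat.finite_of_card_ne_zero h0
    rw [← (IsDiscreteValuationRing.irreducible_iff_uniformizer ϖ).mp hϖ] at this
    exact this
  have hcomplete : CompleteSpace (Valued.integer (v.adicCompletion k)) :=
    (Valued.isClosed_integer (v.adicCompletion k)).completeSpace_coe
  have hc : CompactSpace (Valued.integer (v.adicCompletion k)) :=
    Valued.integer.compactSpace_iff_completeSpace_and_isDiscreteValuationRing_and_finite_residueField.mpr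
      ⟨hcomplete, inferInstanceAs (IsDiscreteValuationRing (v.adicCompletionIntegers k)), hfin⟩
  have h2 := isCompact_iff_compactSpace.mpr hc
  refine h2.of_isClosed_subset ?_ fun x hx => Valued.toNormedField.norm_le_one_iff.mp hx
  exact isClosed_le continuous_norm continuous_const

end LocalField

end DivAlg

noncomputable section
namespace DivAlg

/-! ### Index and determinant over the local ring of integers. -/

section FreeModule

variable {k : Type*} [Field k] [NumberField k] (v : HeightOneSpectrum (𝓞 k))
  {M : Type*} [AddCommGroup M] [Module (v.adicCompletionIntegers k) M]
  [Module.Free (v.adicCompletionIntegers k) M] [Module.Finite (v.adicCompletionIntegers k) M]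

/-- The index of the image of an endomorphism of a finite free module is the inverse of the
absolute value of its determinant. -/
theorem index_range (f : M →ₗ[v.adicCompletionIntegers k] M) (hf : LinearMap.det f ≠ 0) :
    ((LinearMap.range f).toAddSubgroup.index : ℝ) =
      ‖((LinearMap.det f : v.adicCompletionIntegers k) : v.adicCompletion k)‖⁻¹ := by
  classical
  let b := Module.finBasis (v.adicCompletionIntegers k) M
  have hinj : Function.Injective f := by
    rw [injective_iff_map_eq_zero]
    intro x hx
    have h := LinearMap.toMatrix_mulVec_repr b b f x
    rw [hx, map_zero, Finsupp.coe_zero] at h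
    rw [← LinearMap.det_toMatrix b] at hf
    have h2 := Matrix.mulVec_injective_of_det_ne_zero hf (h.trans (Matrix.mulVec_zero _).symm)
    exact b.repr.map_eq_zero_iff.mp (DFunLike.coe_injective h2)
  let e := LinearEquiv.ofInjective f hinj
  -- In Smith normal form the index is the product of the indices of the `(a i)`. The map `f`
  -- differs from `diag(a)` by an automorphism, so its determinant is associated to `∏ a i`.
  obtain ⟨b', a, ab', hab⟩ := Submodule.exists_smith_normal_form_of_rank_eq b
    (N := LinearMap.range f) e.finrank_eq.symm
  let snf : Basis.SmithNormalForm (LinearMap.range f)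
      (Fin (finrank (v.adicCompletionIntegers k) M))
      (finrank (v.adicCompletionIntegers k) M) := ⟨b', ab', .refl _, a, hab⟩
  rw [snf.toAddSubgroup_index_eq_pow_mul_prod, Fintype.card_fin, Nat.sub_self, pow_zero, one_mul]
  let e' : M ≃ₗ[v.adicCompletionIntegers k] LinearMap.range f := b'.equiv ab' (Equiv.refl _)
  have h1 : LinearMap.det ((LinearMap.range f).subtype ∘ₗ (e' : M →ₗ[_] _)) = ∏ i, a i := by
    rw [← LinearMap.det_toMatrix b', ← Matrix.det_diagonal]
    congr 1
    ext i j
    simp only [LinearMap.toMatrix_apply, LinearMap.comp_apply, Submodule.subtype_apply, e',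
      LinearEquiv.coe_coe, Basis.equiv_apply, Equiv.refl_apply, hab, map_smul, Basis.repr_self,
      Finsupp.smul_apply, smul_eq_mul, Matrix.diagonal_apply, Finsupp.single_apply]
    by_cases hij : i = j
    · subst hij; simp
    · simp [hij, Ne.symm hij]
  have h2 : (LinearMap.range f).subtype ∘ₗ (e : M →ₗ[_] _) = f := by
    ext x; simp [e]
  have h3 : Associated (LinearMap.det f) (∏ i, a i) := by
    rw [← h1]
    conv_lhs => rw [← h2]
    exact LinearMap.associated_det_comp_equiv _ e e'
  obtain ⟨u, hu⟩ := h3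
  have h4 : ‖((LinearMap.det f : v.adicCompletionIntegers k) : v.adicCompletion k)‖ =
      ∏ i, ‖((a i : v.adicCompletionIntegers k) : v.adicCompletion k)‖ := by
    have h5 := congrArg (fun x : v.adicCompletionIntegers k => ‖(x : v.adicCompletion k)‖) hu
    simp only [MulMemClass.coe_mul, norm_mul, norm_isUnit_eq_one v u.isUnit, mul_one] at h5
    rw [h5, ← norm_prod]
    congr 1
    exact map_prod (v.adicCompletionIntegers k).subtype a _
  have ha : ∀ i, a i ≠ 0 := by
    intro i hi
    have : ∏ i, a i = 0 := Finset.prod_eq_zero (Finset.mem_univ i) hi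
    rw [← hu] at this
    exact hf ((mul_eq_zero.mp this).resolve_right u.ne_zero)
  rw [h4, ← Finset.prod_inv_distrib, Nat.cast_prod]
  exact Finset.prod_congr rfl fun i _ => index_span_singleton v (a i) (ha i)

end FreeModule

/-! ### Endomorphisms preserving a lattice in a vector space over a completion. -/

section Lattice

variable {k : Type*} [Field k] [NumberField k] (v : HeightOneSpectrum (𝓞 k))
  {V : Type*} [AddCommGroup V] [Module (v.adicCompletionIntegers k) V]
  [Module (v.adicCompletion k) V] [IsScalarTower (v.adicCompletionIntegers k) (v.adicCompletion k) V]
  (M : Submodule (v.adicCompletionIntegers k) V) [Submodule.IsLattice (v.adicCompletion k) M]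

theorem repr_extendOfIsLattice {κ : Type*} (b : Basis κ (v.adicCompletionIntegers k) M) (x : M)
    (i : κ) : (b.extendOfIsLattice (v.adicCompletion k)).repr (x : V) i =
      ((b.repr x i : v.adicCompletionIntegers k) : v.adicCompletion k) := by
  conv_lhs => rw [← b.linearCombination_repr x]
  rw [Finsupp.linearCombination_apply, Finsupp.sum, Submodule.coe_sum, map_sum,
    Finsupp.finsetSum_apply]
  simp only [Submodule.coe_smul]
  have : ∀ j, (((b.repr x j) • (b j : V)) : V) =
      ((b.repr x j : v.adicCompletionIntegers k) : v.adicCompletion k) •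
        b.extendOfIsLattice (v.adicCompletion k) j := fun j => by
    rw [Basis.extendOfIsLattice_apply]
    exact (algebraMap_smul (v.adicCompletion k) (b.repr x j) (b j : V)).symm
  classical
  simp only [this, map_smul, Basis.repr_self, Finsupp.smul_apply, smul_eq_mul]
  simp only [Finsupp.single_apply, mul_ite, mul_one, mul_zero]
  rw [Finset.sum_ite_eq']
  split_ifs with h
  · rfl
  · rw [Finsupp.notMem_support_iff.mp h]; rfl

variable {M}

theorem free_of_isLattice (M : Submodule (v.adicCompletionIntegers k) V)
    [Submodule.IsLattice (v.adicCompletion k) M] : Module.Free (v.adicCompletionIntegers k) M :=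
  Submodule.IsLattice.free (v.adicCompletion k) M

theorem finite_of_isLattice (M : Submodule (v.adicCompletionIntegers k) V)
    [Submodule.IsLattice (v.adicCompletion k) M] : Module.Finite (v.adicCompletionIntegers k) M :=
  Submodule.IsLattice.finite (v.adicCompletion k) M

/-- A basis of the lattice over the local integers is also a basis of `V` over the field, and `f`
has the same matrix in both. -/
theorem det_restrict_eq (f : V →ₗ[v.adicCompletion k] V) (hf : ∀ x ∈ M, f x ∈ M) :
    ((LinearMap.det ((f.restrictScalars (v.adicCompletionIntegers k)).restrict hf) :
      v.adicCompletionIntegers k) : v.adicCompletion k) = LinearMap.det f := by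
  have := free_of_isLattice v M
  have := finite_of_isLattice v M
  classical
  let b := Module.finBasis (v.adicCompletionIntegers k) M
  rw [← LinearMap.det_toMatrix b, ← LinearMap.det_toMatrix (b.extendOfIsLattice (v.adicCompletion k))]
  change (v.adicCompletionIntegers k).subtype _ = _
  rw [RingHom.map_det]
  congr 1
  refine Matrix.ext fun i j => ?_
  rw [LinearMap.toMatrix_apply, Basis.extendOfIsLattice_apply, RingHom.mapMatrix_apply,
    Matrix.map_apply, LinearMap.toMatrix_apply]
  exact (repr_extendOfIsLattice v M b ⟨f (b j), hf _ (b j).2⟩ i).symm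

theorem norm_det_le_one (f : V →ₗ[v.adicCompletion k] V) (hf : ∀ x ∈ M, f x ∈ M) :
    ‖LinearMap.det f‖ ≤ 1 := by
  rw [← det_restrict_eq v f hf, norm_le_one_iff_mem]
  exact Subtype.coe_prop _

/-- A determinant of norm one is a unit of the local integers, so `f` restricts to an automorphism
of the lattice. -/
theorem exists_preimage_of_norm_det_eq_one (f : V →ₗ[v.adicCompletion k] V)
    (hf : ∀ x ∈ M, f x ∈ M) (h1 : ‖LinearMap.det f‖ = 1) (y : V) (hy : y ∈ M) :
    ∃ x ∈ M, f x = y := by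
  have := free_of_isLattice v M
  have := finite_of_isLattice v M
  rw [← det_restrict_eq v f hf, norm_eq_one_iff_isUnit] at h1
  let e := LinearEquiv.ofIsUnitDet (f := (f.restrictScalars
    (v.adicCompletionIntegers k)).restrict hf) (v := Module.finBasis _ M)
    (v' := Module.finBasis _ M) (by rwa [LinearMap.det_toMatrix])
  refine ⟨e.symm ⟨y, hy⟩, Subtype.coe_prop _, ?_⟩
  exact congrArg Subtype.val (e.apply_symm_apply ⟨y, hy⟩)

theorem relIndex_map (f : V →ₗ[v.adicCompletion k] V) (hf : ∀ x ∈ M, f x ∈ M)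
    (h0 : LinearMap.det f ≠ 0) :
    ((M.toAddSubgroup.map (f : V →+ V)).relIndex M.toAddSubgroup : ℝ) =
      ‖LinearMap.det f‖⁻¹ := by
  have := free_of_isLattice v M
  have := finite_of_isLattice v M
  rw [← det_restrict_eq v f hf, ← index_range]
  · rw [AddSubgroup.relIndex]
    congr 2
    ext x
    simp only [AddSubgroup.mem_addSubgroupOf, AddSubgroup.mem_map, Submodule.mem_toAddSubgroup,
      LinearMap.mem_range]
    constructor
    · rintro ⟨y, hy, hyx⟩
      exact ⟨⟨y, hy⟩, Subtype.ext hyx⟩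
    · rintro ⟨y, rfl⟩
      exact ⟨y, y.2, rfl⟩
  · rintro h
    apply h0
    rw [← det_restrict_eq v f hf, h]
    rfl

end Lattice

end DivAlg

noncomputable section
namespace DivAlg

/-! ### The completions `D_v` as subrings and lattices of `B_v`. -/

section LocalOrder

variable {k : Type*} [Field k] [NumberField k] {B : Type*} [DivisionRing B] [Algebra k B]

/-- The completion of an order at a finite place, as a module over the ring of integers of the
completion. -/
def localLattice (D : Subalgebra (𝓞 k) B) (v : HeightOneSpectrum (𝓞 k)) :
    Submodule (v.adicCompletionIntegers k) (AtFin B v) :=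
  Submodule.span _ ((fun x : B => (1 : v.adicCompletion k) ⊗ₜ[k] x) '' (D : Set B))

theorem integers_smul_tmul {v : HeightOneSpectrum (𝓞 k)} (a : v.adicCompletionIntegers k)
    (b : v.adicCompletion k) (x : B) :
    a • (b ⊗ₜ[k] x : AtFin B v) = ((a : v.adicCompletion k) * b) ⊗ₜ[k] x :=
  rfl

theorem localLattice_toAddSubgroup (D : Subalgebra (𝓞 k) B) (v : HeightOneSpectrum (𝓞 k)) :
    (localLattice D v).toAddSubgroup = localOrder D v := by
  apply le_antisymm
  · intro x hx
    rw [Submodule.mem_toAddSubgroup] at hx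
    refine Submodule.closure_induction (p := fun x _ => x ∈ localOrder D v) (zero_mem _)
      (fun _ _ _ _ => add_mem) ?_ hx
    rintro a _ ⟨y, hy, rfl⟩
    refine AddSubgroup.subset_closure ⟨a, a.2, y, hy, ?_⟩
    simp only [integers_smul_tmul, mul_one]
  · rw [localOrder, AddSubgroup.closure_le]
    rintro _ ⟨a, ha, x, hx, rfl⟩
    have h := (localLattice D v).smul_mem ⟨a, ha⟩ (Submodule.subset_span ⟨x, hx, rfl⟩)
    rwa [integers_smul_tmul, mul_one] at h

theorem mem_localLattice {D : Subalgebra (𝓞 k) B} {v : HeightOneSpectrum (𝓞 k)} {x : AtFin B v} :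
    x ∈ localLattice D v ↔ x ∈ localOrder D v := by
  rw [← localLattice_toAddSubgroup, Submodule.mem_toAddSubgroup]

theorem tmul_mem_localOrder {D : Subalgebra (𝓞 k) B} {v : HeightOneSpectrum (𝓞 k)}
    {a : v.adicCompletion k} (ha : ‖a‖ ≤ 1) {x : B} (hx : x ∈ D) :
    a ⊗ₜ[k] x ∈ localOrder D v :=
  AddSubgroup.subset_closure ⟨a, (norm_le_one_iff_mem v a).mp ha, x, hx, rfl⟩

theorem one_tmul_mem_localOrder {D : Subalgebra (𝓞 k) B} (v : HeightOneSpectrum (𝓞 k))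
    {x : B} (hx : x ∈ D) : (1 : v.adicCompletion k) ⊗ₜ[k] x ∈ localOrder D v :=
  tmul_mem_localOrder (by simp) hx

theorem one_mem_localOrder (D : Subalgebra (𝓞 k) B) (v : HeightOneSpectrum (𝓞 k)) :
    (1 : AtFin B v) ∈ localOrder D v :=
  one_tmul_mem_localOrder v D.one_mem

theorem smul_mem_localOrder {D : Subalgebra (𝓞 k) B} {v : HeightOneSpectrum (𝓞 k)}
    {a : v.adicCompletion k} (ha : ‖a‖ ≤ 1) {x : AtFin B v} (hx : x ∈ localOrder D v) :
    a • x ∈ localOrder D v := by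
  rw [← mem_localLattice] at hx ⊢
  exact (localLattice D v).smul_mem ⟨a, (norm_le_one_iff_mem v a).mp ha⟩ hx

theorem mul_mem_localOrder {D : Subalgebra (𝓞 k) B} {v : HeightOneSpectrum (𝓞 k)}
    {x y : AtFin B v} (hx : x ∈ localOrder D v) (hy : y ∈ localOrder D v) :
    x * y ∈ localOrder D v := by
  refine AddSubgroup.closure_induction (p := fun x _ => x * y ∈ localOrder D v) ?_
    (by simp) (fun a b _ _ ha hb => by rw [add_mul]; exact add_mem ha hb)
    (fun a _ ha => by rw [neg_mul]; exact neg_mem ha) hx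
  rintro _ ⟨a, ha, x, hx, rfl⟩
  refine AddSubgroup.closure_induction (p := fun y _ => (a ⊗ₜ[k] x) * y ∈ localOrder D v) ?_
    (by simp) (fun a b _ _ ha hb => by rw [mul_add]; exact add_mem ha hb)
    (fun a _ ha => by rw [mul_neg]; exact neg_mem ha) hy
  rintro _ ⟨b, hb, y, hy, rfl⟩
  rw [Algebra.TensorProduct.tmul_mul_tmul]
  exact AddSubgroup.subset_closure ⟨a * b, mul_mem ha hb, x * y, mul_mem hx hy, rfl⟩

theorem coe_int_mul (r s : 𝓞 k) : ((r * s : 𝓞 k) : k) = (r : k) * s :=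
  map_mul (algebraMap (𝓞 k) k) r s

theorem smul_eq_one_tmul_mul {v : HeightOneSpectrum (𝓞 k)} (a : k) (x : AtFin B v) :
    a • x = ((1 : v.adicCompletion k) ⊗ₜ[k] (algebraMap k B a)) * x := by
  induction x using TensorProduct.induction_on with
  | zero => simp
  | add x y hx hy => rw [smul_add, mul_add, hx, hy]
  | tmul b y =>
    rw [Algebra.TensorProduct.tmul_mul_tmul, one_mul, ← TensorProduct.tmul_smul,
      Algebra.smul_def]

theorem algebraMap_smul_atFin {v : HeightOneSpectrum (𝓞 k)} (a : k) (x : AtFin B v) :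
    (algebraMap k (v.adicCompletion k) a) • x = a • x :=
  algebraMap_smul _ _ _

theorem int_smul_mem_localOrder {D : Subalgebra (𝓞 k) B} {v : HeightOneSpectrum (𝓞 k)}
    (r : 𝓞 k) {x : AtFin B v} (hx : x ∈ localOrder D v) : (r : k) • x ∈ localOrder D v := by
  rw [← algebraMap_smul_atFin]
  exact smul_mem_localOrder (norm_algebraMap_int_le_one v r) hx

variable {D : Subalgebra (𝓞 k) B} (hD : IsOrder D)
include hD

theorem IsOrder.exists_smul_mem (x : B) : ∃ r : 𝓞 k, r ≠ 0 ∧ (r : k) • x ∈ D := by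
  have hx : x ∈ Submodule.span k (D : Set B) := hD.span_eq_top ▸ Submodule.mem_top
  induction hx using Submodule.span_induction with
  | mem x hx => exact ⟨1, one_ne_zero, by simpa using hx⟩
  | zero => exact ⟨1, one_ne_zero, by simp⟩
  | add x y _ _ hx hy =>
    obtain ⟨r, hr, hrx⟩ := hx
    obtain ⟨s, hs, hsy⟩ := hy
    refine ⟨r * s, mul_ne_zero hr hs, ?_⟩
    have h1 := D.smul_mem hrx s
    have h2 := D.smul_mem hsy r
    have h3 : ((r * s : 𝓞 k) : k) • (x + y) = s • ((r : k) • x) + r • ((s : k) • y) := by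
      rw [← algebraMap_smul k s, ← algebraMap_smul k r, smul_add, smul_smul, smul_smul,
        coe_int_mul, mul_comm]
    rw [h3]
    exact add_mem h1 h2
  | smul a x _ hx =>
    obtain ⟨r, hr, hrx⟩ := hx
    obtain ⟨n, d, hd, rfl⟩ := IsFractionRing.div_surjective (A := 𝓞 k) a
    have hd0 : (d : k) ≠ 0 := by simpa using nonZeroDivisors.ne_zero hd
    refine ⟨r * d, mul_ne_zero hr (nonZeroDivisors.ne_zero hd), ?_⟩
    have h1 := D.smul_mem hrx n
    have h3 : ((r * d : 𝓞 k) : k) • ((algebraMap (𝓞 k) k n / algebraMap (𝓞 k) k d) • x) =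
        n • ((r : k) • x) := by
      rw [← algebraMap_smul k n, smul_smul, smul_smul, coe_int_mul]
      congr 1
      rw [mul_assoc, mul_div_cancel₀ _ hd0, mul_comm]
    rw [h3]
    exact h1

theorem IsOrder.exists_smul_mem_localOrder {v : HeightOneSpectrum (𝓞 k)} (x : AtFin B v) :
    ∃ r : 𝓞 k, r ≠ 0 ∧ (r : k) • x ∈ localOrder D v := by
  induction x using TensorProduct.induction_on with
  | zero => exact ⟨1, one_ne_zero, by simp⟩
  | add x y hx hy =>
    obtain ⟨r, hr, hrx⟩ := hx
    obtain ⟨s, hs, hsy⟩ := hy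
    refine ⟨r * s, mul_ne_zero hr hs, ?_⟩
    rw [smul_add]
    refine add_mem ?_ ?_
    · rw [mul_comm, coe_int_mul, ← smul_smul]
      exact int_smul_mem_localOrder s hrx
    · rw [coe_int_mul, ← smul_smul]
      exact int_smul_mem_localOrder r hsy
  | tmul a x =>
    obtain ⟨r, hr, hrx⟩ := hD.exists_smul_mem x
    obtain ⟨y, hy⟩ := exists_norm_sub_le v a one_pos
    obtain ⟨n, d, hd, rfl⟩ := IsFractionRing.div_surjective (A := 𝓞 k) y
    have hd0 : (d : k) ≠ 0 := by simpa using nonZeroDivisors.ne_zero hd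
    refine ⟨r * d, mul_ne_zero hr (nonZeroDivisors.ne_zero hd), ?_⟩
    have h1 : ((r * d : 𝓞 k) : k) • (a ⊗ₜ[k] x : AtFin B v) =
        (algebraMap k _ (d : k) * a) ⊗ₜ[k] ((r : k) • x) := by
      rw [coe_int_mul, ← smul_smul, TensorProduct.smul_tmul', TensorProduct.smul_tmul',
        TensorProduct.tmul_smul, TensorProduct.smul_tmul', Algebra.smul_def (d : k) a]
    rw [h1]
    refine tmul_mem_localOrder ?_ hrx
    -- The fraction `n / d` is within `1` of `a`; hence `d * a` is the sum of `n` and an element of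
    -- norm at most `1`.
    have h2 : algebraMap k (v.adicCompletion k) (d : k) * a =
        algebraMap k _ (d : k) * (a - algebraMap k _ (algebraMap (𝓞 k) k n / algebraMap (𝓞 k) k d))
          - - algebraMap k _ (n : k) := by
      rw [mul_sub, ← map_mul, mul_div_cancel₀ _ hd0]
      ring
    rw [h2]
    refine (norm_sub_le_max_norm v _ _).trans (max_le ?_ ?_)
    · rw [norm_mul]
      exact mul_le_one₀ (norm_algebraMap_int_le_one v d) (norm_nonneg _) hy
    · rw [norm_neg]
      exact norm_algebraMap_int_le_one v n

theorem IsOrder.isLattice (v : HeightOneSpectrum (𝓞 k)) :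
    Submodule.IsLattice (v.adicCompletion k) (localLattice D v) where
  fg := by
    obtain ⟨s, hs⟩ := hD.fg
    classical
    refine ⟨s.image (fun x : B => (1 : v.adicCompletion k) ⊗ₜ[k] x), ?_⟩
    apply le_antisymm
    · rw [Submodule.span_le]
      intro x hx
      rw [Finset.coe_image] at hx
      obtain ⟨y, hy, rfl⟩ := hx
      refine Submodule.subset_span ⟨y, ?_, rfl⟩
      have : y ∈ Submodule.span (𝓞 k) (s : Set B) := Submodule.subset_span hy
      rw [hs] at this
      exact this
    · rw [localLattice, Submodule.span_le]
      rintro _ ⟨y, hy, rfl⟩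
      have : y ∈ Submodule.span (𝓞 k) (s : Set B) := by rw [hs]; exact hy
      clear hy
      induction this using Submodule.span_induction with
      | mem x hx =>
        refine Submodule.subset_span ?_
        rw [Finset.coe_image]
        exact ⟨x, hx, rfl⟩
      | zero => simp
      | add x y _ _ hx hy => simp only [TensorProduct.tmul_add]; exact add_mem hx hy
      | smul a x _ hx =>
        have h : (1 : v.adicCompletion k) ⊗ₜ[k] (a • x) =
            (algebraMap (𝓞 k) (v.adicCompletionIntegers k) a) •
              ((1 : v.adicCompletion k) ⊗ₜ[k] x) := by
          rw [integers_smul_tmul, ← algebraMap_smul k a x, TensorProduct.tmul_smul,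
            TensorProduct.smul_tmul', Algebra.smul_def]
          rfl
        simp only [h]
        exact Submodule.smul_mem _ _ hx
  span_eq_top := by
    rw [eq_top_iff]
    intro x _
    obtain ⟨r, hr, hrx⟩ := hD.exists_smul_mem_localOrder x
    have hr0 : (r : k) ≠ 0 := by simpa using hr
    have h : x = (algebraMap k (v.adicCompletion k) (r : k)⁻¹) • ((r : k) • x) := by
      rw [algebraMap_smul_atFin, smul_smul, inv_mul_cancel₀ hr0, one_smul]
    rw [h]
    exact Submodule.smul_mem _ _ (Submodule.subset_span (mem_localLattice.mpr hrx))

end LocalOrder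

end DivAlg

noncomputable section
namespace DivAlg

/-! ### Local norms of integral elements, and local indices. -/

section LocalNorm

variable {k : Type*} [Field k] [NumberField k] {B : Type*} [DivisionRing B] [Algebra k B]
  {D : Subalgebra (𝓞 k) B} {v : HeightOneSpectrum (𝓞 k)}

theorem absNormFin_mul (x y : AtFin B v) :
    absNormFin v (x * y) = absNormFin v x * absNormFin v y := by
  rw [absNormFin, map_mul, norm_mul]; rfl

theorem absNormFin_one : absNormFin v (1 : AtFin B v) = 1 := by
  rw [absNormFin, map_one, norm_one]

theorem absNormFin_nonneg (x : AtFin B v) : 0 ≤ absNormFin v x := norm_nonneg _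

theorem absNormFin_units_pos (x : (AtFin B v)ˣ) : 0 < absNormFin v (x : AtFin B v) :=
  norm_pos_iff.mpr (x.isUnit.map (Algebra.norm (v.adicCompletion k))).ne_zero

theorem absNormFin_units_inv (x : (AtFin B v)ˣ) :
    absNormFin v ((x⁻¹ : (AtFin B v)ˣ) : AtFin B v) = (absNormFin v (x : AtFin B v))⁻¹ := by
  rw [absNormFin, map_units_inv, norm_inv]; rfl

theorem absNormFin_one_tmul [FiniteDimensional k B] (v : HeightOneSpectrum (𝓞 k)) (x : B) :
    absNormFin v ((1 : v.adicCompletion k) ⊗ₜ[k] x) = FinitePlace.mk v (Algebra.norm k x) := by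
  rw [absNormFin, norm_one_tmul]; rfl

theorem absNormFin_le_one (hD : IsOrder D) {x : AtFin B v} (hx : x ∈ localOrder D v) :
    absNormFin v x ≤ 1 := by
  have := hD.isLattice v
  refine norm_det_le_one v (M := localLattice D v) (LinearMap.mulLeft (v.adicCompletion k) x)
    fun y hy => ?_
  rw [mem_localLattice] at hy ⊢
  exact mul_mem_localOrder hx hy

/-- Left multiplication by `x` is an automorphism of the lattice `D_v`; the preimage of `1` is the
inverse. -/
theorem inv_mem_localOrder (hD : IsOrder D) {x : (AtFin B v)ˣ}
    (hx : (x : AtFin B v) ∈ localOrder D v) (h1 : absNormFin v (x : AtFin B v) = 1) :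
    ((x⁻¹ : (AtFin B v)ˣ) : AtFin B v) ∈ localOrder D v := by
  have := hD.isLattice v
  obtain ⟨y, hy, hxy⟩ := exists_preimage_of_norm_det_eq_one v (M := localLattice D v)
    (LinearMap.mulLeft (v.adicCompletion k) (x : AtFin B v)) (fun y hy => by
      rw [mem_localLattice] at hy ⊢
      exact mul_mem_localOrder hx hy) h1 1 (mem_localLattice.mpr (one_mem_localOrder D v))
  rw [LinearMap.mulLeft_apply] at hxy
  have h : ((x⁻¹ : (AtFin B v)ˣ) : AtFin B v) = y := by
    rw [← mul_one ((x⁻¹ : (AtFin B v)ˣ) : AtFin B v), ← hxy, Units.inv_mul_cancel_left]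
  rw [h]
  exact mem_localLattice.mp hy

theorem relIndex_mulLeft (hD : IsOrder D) {x : (AtFin B v)ˣ}
    (hx : (x : AtFin B v) ∈ localOrder D v) :
    (((localOrder D v).map (AddMonoidHom.mulLeft (x : AtFin B v))).relIndex (localOrder D v) : ℝ)
      = (absNormFin v (x : AtFin B v))⁻¹ := by
  have := hD.isLattice v
  rw [← localLattice_toAddSubgroup]
  refine relIndex_map v (M := localLattice D v)
    (LinearMap.mulLeft (v.adicCompletion k) (x : AtFin B v)) (fun y hy => ?_) ?_
  · rw [mem_localLattice] at hy ⊢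
    exact mul_mem_localOrder hx hy
  · exact norm_pos_iff.mp (absNormFin_units_pos x)

theorem relIndex_mulRight [Algebra.IsCentral k B] [FiniteDimensional k B] {d : ℕ}
    (hd : finrank k B = d ^ 2) (hD : IsOrder D) {x : (AtFin B v)ˣ}
    (hx : (x : AtFin B v) ∈ localOrder D v) :
    (((localOrder D v).map (AddMonoidHom.mulRight (x : AtFin B v))).relIndex (localOrder D v) : ℝ)
      = (absNormFin v (x : AtFin B v))⁻¹ := by
  have := hD.isLattice v
  have h := det_mulRight_eq_norm hd (v.adicCompletion k) (x : AtFin B v)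
  rw [← localLattice_toAddSubgroup, absNormFin, ← h]
  refine relIndex_map v (M := localLattice D v)
    (LinearMap.mulRight (v.adicCompletion k) (x : AtFin B v)) (fun y hy => ?_) ?_
  · rw [mem_localLattice] at hy ⊢
    exact mul_mem_localOrder hy hx
  · rw [h]
    exact norm_pos_iff.mp (absNormFin_units_pos x)

end LocalNorm

/-! ### Recovering `D` and `D_S` from the local orders. -/

section LocalGlobal

variable {k : Type*} [Field k] [NumberField k] {B : Type*} [DivisionRing B] [Algebra k B]
  {D : Subalgebra (𝓞 k) B}

theorem IsOrder.isLocalizedModule (hD : IsOrder D) :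
    IsLocalizedModule (nonZeroDivisors (𝓞 k)) (Subalgebra.toSubmodule D).subtype where
  map_units a := by
    have ha : (algebraMap (𝓞 k) k a) ≠ 0 := by
      simp
    rw [Module.End.isUnit_iff]
    constructor
    · intro x y hxy
      simp only [Module.algebraMap_end_apply, ← algebraMap_smul k (a : 𝓞 k)] at hxy
      exact smul_right_injective _ ha hxy
    · intro x
      refine ⟨(algebraMap (𝓞 k) k a)⁻¹ • x, ?_⟩
      rw [Module.algebraMap_end_apply, ← algebraMap_smul k (a : 𝓞 k), smul_smul,
        mul_inv_cancel₀ ha, one_smul]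
  surj y := by
    obtain ⟨r, hr, hry⟩ := hD.exists_smul_mem y
    refine ⟨⟨⟨(r : k) • y, hry⟩, ⟨r, mem_nonZeroDivisors_of_ne_zero hr⟩⟩, ?_⟩
    exact (algebraMap_smul k r y).symm
  exists_of_eq {x y} h := ⟨1, by rw [Subtype.ext h]⟩

/-- An order, being projective over the ring of integers, has a dual basis. -/
theorem IsOrder.exists_dual_basis (hD : IsOrder D) :
    ∃ (n : ℕ) (x : Fin n → B) (l : Fin n → B →ₗ[k] k), (∀ i, x i ∈ D) ∧
      (∀ i, ∀ y ∈ D, ∃ r : 𝓞 k, l i y = r) ∧ ∀ y, y = ∑ i, l i y • x i := by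
  have hloc := hD.isLocalizedModule
  have : Module.Finite (𝓞 k) (Subalgebra.toSubmodule D) := Module.Finite.iff_fg.mpr hD.fg
  have : Module.IsTorsionFree (𝓞 k) B := Module.IsTorsionFree.trans_faithfulSMul (𝓞 k) k B
  -- A torsion-free module over a Dedekind domain is flat, and a finitely presented flat module is
  -- projective.
  have : Module.Projective (𝓞 k) (Subalgebra.toSubmodule D) :=
    have : Module.FinitePresentation (𝓞 k) (Subalgebra.toSubmodule D) :=
      Module.finitePresentation_of_finite _ _
    Module.Flat.projective_of_finitePresentation
  obtain ⟨n, p, hp⟩ := Module.Finite.exists_fin' (𝓞 k) (Subalgebra.toSubmodule D)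
  obtain ⟨s, hs⟩ := Module.projective_lifting_property p LinearMap.id hp
  -- The coordinate functionals on `D` extend to `B` because `B` is the localization of `D` at the
  -- nonzero integers.
  let ext := IsLocalizedModule.mapExtendScalars (nonZeroDivisors (𝓞 k))
    (Subalgebra.toSubmodule D).subtype (Algebra.linearMap (𝓞 k) k) k
  let l : Fin n → B →ₗ[k] k := fun i => ext ((LinearMap.proj i) ∘ₗ s)
  have hl : ∀ i (y : Subalgebra.toSubmodule D), l i y = ((s y i : 𝓞 k) : k) := fun i y =>
    IsLocalizedModule.map_apply (nonZeroDivisors (𝓞 k)) (Subalgebra.toSubmodule D).subtype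
      (Algebra.linearMap (𝓞 k) k) _ y
  let x : Fin n → B := fun i => p (Pi.single i 1)
  have hDeq : ∀ y : Subalgebra.toSubmodule D, (y : B) = ∑ i, l i y • x i := by
    intro y
    have h1 : p (s y) = y := LinearMap.congr_fun hs y
    conv_lhs => rw [← h1, ← LinearMap.sum_single_apply (fun _ : Fin n => 𝓞 k) (s y)]
    rw [map_sum, Submodule.coe_sum]
    refine Finset.sum_congr rfl fun i _ => ?_
    have h2 : (Pi.single i (s y i) : Fin n → 𝓞 k) =
        s y i • (Pi.single i 1 : Fin n → 𝓞 k) := by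
      rw [← Pi.single_smul, smul_eq_mul, mul_one]
    rw [hl, h2, map_smul, Submodule.coe_smul, ← algebraMap_smul k (s y i)]
  refine ⟨n, x, l, fun i => Subtype.coe_prop _, fun i y hy => ⟨s ⟨y, hy⟩ i, hl i ⟨y, hy⟩⟩, fun y => ?_⟩
  obtain ⟨r, hr, hry⟩ := hD.exists_smul_mem y
  have hr0 : (r : k) ≠ 0 := by simpa using hr
  have h2 := hDeq ⟨(r : k) • y, hry⟩
  simp only [map_smul, smul_assoc] at h2
  rw [← Finset.smul_sum] at h2
  exact smul_right_injective _ hr0 h2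

/-- The `k_v`-linear extension of `l` is integral on the generators of `D_v`, hence on all of `D_v`
by the ultrametric inequality. With a dual basis of `D`, this turns local integrality of an element
into integrality of its coordinates. -/
theorem norm_functional_le_one {l : B →ₗ[k] k} (hl : ∀ y ∈ D, ∃ r : 𝓞 k, l y = r)
    {v : HeightOneSpectrum (𝓞 k)} {y : B}
    (hy : (1 : v.adicCompletion k) ⊗ₜ[k] y ∈ localOrder D v) :
    ‖algebraMap k (v.adicCompletion k) (l y)‖ ≤ 1 := by
  let L : AtFin B v →ₗ[v.adicCompletion k] v.adicCompletion k :=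
    (AlgebraTensorModule.rid k (v.adicCompletion k) (v.adicCompletion k)).toLinearMap ∘ₗ
      l.baseChange _
  have hL : ∀ a x, L (a ⊗ₜ x) = a * algebraMap k _ (l x) := fun a x => by
    simp [L, Algebra.smul_def, mul_comm]
  have h : ∀ z ∈ localOrder D v, ‖L z‖ ≤ 1 := by
    intro z hz
    refine AddSubgroup.closure_induction (p := fun z _ => ‖L z‖ ≤ 1) ?_ (by simp)
      (fun x y _ _ hx hy => ?_) (fun x _ hx => by rwa [map_neg, norm_neg]) hz
    · rintro _ ⟨a, ha, x, hx, rfl⟩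
      obtain ⟨r, hr⟩ := hl x hx
      rw [hL, hr, norm_mul]
      exact mul_le_one₀ ((norm_le_one_iff_mem v a).mpr ha) (norm_nonneg _)
        (norm_algebraMap_int_le_one v r)
    · rw [map_add]
      exact (IsUltrametricDist.norm_add_le_max _ _).trans (max_le hx hy)
  have h1 := h _ hy
  rwa [hL, one_mul] at h1

theorem mem_of_forall_mem_localOrder (hD : IsOrder D) {y : B}
    (hy : ∀ v : HeightOneSpectrum (𝓞 k), (1 : v.adicCompletion k) ⊗ₜ[k] y ∈ localOrder D v) :
    y ∈ D := by
  obtain ⟨n, x, l, hx, hl, hsum⟩ := hD.exists_dual_basis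
  rw [hsum y]
  refine sum_mem fun i _ => ?_
  obtain ⟨r, hr⟩ := HeightOneSpectrum.mem_integers_of_valuation_le_one k (l i y) fun v =>
    (valuation_le_one_iff_norm v _).mpr (norm_functional_le_one (hl i) (hy v))
  rw [← hr, algebraMap_smul]
  exact D.smul_mem (hx i) r

theorem mem_sOrder_iff (hD : IsOrder D) (S : Finset (HeightOneSpectrum (𝓞 k))) {y : B} :
    y ∈ sOrder S D ↔ ∀ v ∉ S, (1 : v.adicCompletion k) ⊗ₜ[k] y ∈ localOrder D v := by
  constructor
  · intro hy v hv
    induction hy using Algebra.adjoin_induction with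
    | mem x hx => exact one_tmul_mem_localOrder v hx
    | algebraMap r =>
      have h : (1 : v.adicCompletion k) ⊗ₜ[k]
          (algebraMap ((S : Set (HeightOneSpectrum (𝓞 k))).integer k) B r) =
          (algebraMap k (v.adicCompletion k) (r : k)) ⊗ₜ[k] (1 : B) := by
        rw [Algebra.algebraMap_eq_smul_one (r : k), TensorProduct.smul_tmul,
          ← Algebra.algebraMap_eq_smul_one (r : k)]
        rfl
      rw [h]
      refine tmul_mem_localOrder ?_ D.one_mem
      exact (valuation_le_one_iff_norm v _).mp (r.2 v (by simpa using hv))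
    | add x y _ _ hx hy => rw [TensorProduct.tmul_add]; exact add_mem hx hy
    | mul x y _ _ hx hy =>
      have h := mul_mem_localOrder hx hy
      rwa [Algebra.TensorProduct.tmul_mul_tmul, one_mul] at h
  · intro hy
    obtain ⟨n, x, l, hx, hl, hsum⟩ := hD.exists_dual_basis
    rw [hsum y]
    refine sum_mem fun i _ => ?_
    have h : l i y ∈ (S : Set (HeightOneSpectrum (𝓞 k))).integer k := fun v hv =>
      (valuation_le_one_iff_norm v _).mpr
        (norm_functional_le_one (hl i) (hy v (by simpa using hv)))
    exact (sOrder S D).smul_mem (Algebra.subset_adjoin (hx i)) ⟨l i y, h⟩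

theorem mem_mulOrder_iff {α : (v : HeightOneSpectrum (𝓞 k)) → (AtFin B v)ˣ} {y : B} :
    y ∈ mulOrder D α ↔ ∀ v, (((α v)⁻¹ : (AtFin B v)ˣ) : AtFin B v) *
      ((1 : v.adicCompletion k) ⊗ₜ[k] y) ∈ localOrder D v := by
  simp only [mulOrder, AddSubgroup.mem_iInf, AddSubgroup.mem_comap, AddSubgroup.mem_map]
  refine forall_congr' fun v => ?_
  constructor
  · rintro ⟨z, hz, hzy⟩
    have h : (1 : v.adicCompletion k) ⊗ₜ[k] y = (α v : AtFin B v) * z := hzy.symm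
    rw [h, Units.inv_mul_cancel_left]
    exact hz
  · intro h
    exact ⟨_, h, Units.mul_inv_cancel_left (α v) _⟩

/-- Simultaneous approximation: an integer close to `1` at one place and as divisible as `c` at all
the others. -/
theorem exists_int_approx (v₀ : HeightOneSpectrum (𝓞 k)) {c : 𝓞 k} (hc : c ≠ 0) :
    ∃ b : 𝓞 k, (∀ v ≠ v₀, ‖algebraMap k (v.adicCompletion k) (b : k)‖ ≤
        ‖algebraMap k (v.adicCompletion k) (c : k)‖) ∧
      ‖algebraMap k (v₀.adicCompletion k) ((1 - b : 𝓞 k) : k)‖ ≤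
        ‖algebraMap k (v₀.adicCompletion k) (c : k)‖ := by
  have hnorm : ∀ (v : HeightOneSpectrum (𝓞 k)) (a b : 𝓞 k),
      v.intValuation a ≤ v.intValuation b →
      ‖algebraMap k (v.adicCompletion k) (a : k)‖ ≤ ‖algebraMap k (v.adicCompletion k) (b : k)‖ := by
    intro v a b h
    rw [Valued.toNormedField.norm_le_iff]
    rw [← HeightOneSpectrum.valuation_of_algebraMap (K := k),
      ← HeightOneSpectrum.valuation_of_algebraMap (K := k)] at h
    exact ((v.valuedAdicCompletion_eq_valuation' _).le.trans h).trans
      (v.valuedAdicCompletion_eq_valuation' _).ge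
  have hexp : ∀ v : HeightOneSpectrum (𝓞 k), ∃ n : ℕ,
      v.intValuation c = WithZero.exp (-(n : ℤ)) := fun v => ⟨_, v.intValuation_if_neg hc⟩
  obtain ⟨n, hn⟩ := hexp v₀
  -- Factor `(c) = 𝔭 ^ n J` with `𝔭` the prime of `v₀` and `J` prime to `𝔭`. In a relation `a + b =
  -- 1` with `a ∈ 𝔭 ^ n` and `b ∈ J`, the element `b` is the required integer.
  obtain ⟨J, hJ⟩ := (v₀.intValuation_le_pow_iff_dvd c n).mp hn.le
  have hcop : IsCoprime (v₀.asIdeal ^ n) J := by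
    apply IsCoprime.pow_left
    rw [Ideal.isCoprime_iff_sup_eq]
    refine v₀.isMaximal.out.2 _ (left_lt_sup.mpr fun h => ?_)
    have h1 : v₀.asIdeal ^ (n + 1) ∣ Ideal.span {c} := by
      rw [hJ, pow_succ]
      exact mul_dvd_mul_left _ (Ideal.dvd_iff_le.mpr h)
    have h2 := (v₀.intValuation_le_pow_iff_dvd c (n + 1)).mpr h1
    rw [hn, WithZero.exp_le_exp] at h2
    push_cast at h2
    omega
  obtain ⟨a, ha, b, hb, hab⟩ := Ideal.isCoprime_iff_exists.mp hcop
  refine ⟨b, fun v hv => hnorm v b c ?_, hnorm v₀ _ _ ?_⟩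
  · obtain ⟨m, hm⟩ := hexp v
    rw [hm, v.intValuation_le_pow_iff_mem]
    have h1 := (v.intValuation_le_pow_iff_dvd c m).mp hm.le
    rw [hJ] at h1
    have hcop2 : IsCoprime (v.asIdeal ^ m) (v₀.asIdeal ^ n) := by
      apply IsCoprime.pow
      rw [Ideal.isCoprime_iff_sup_eq]
      exact Ideal.IsMaximal.coprime_of_ne v.isMaximal v₀.isMaximal
        fun h => hv (HeightOneSpectrum.ext h)
    exact Ideal.dvd_iff_le.mp (hcop2.dvd_of_dvd_mul_left h1) hb
  · rw [hn, v₀.intValuation_le_pow_iff_mem, ← hab, add_sub_cancel_right]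
    exact ha

end LocalGlobal

end DivAlg

noncomputable section
namespace DivAlg

/-! ### The inclusion `α D ⊆ D` is a local condition. -/

section MulOrder

variable {k : Type*} [Field k] [NumberField k] {B : Type*} [DivisionRing B] [Algebra k B]
  {D : Subalgebra (𝓞 k) B} {v : HeightOneSpectrum (𝓞 k)}

theorem smul_mem_localOrder_of_norm_le {a c : k} (hc : c ≠ 0)
    (h : ‖algebraMap k (v.adicCompletion k) a‖ ≤ ‖algebraMap k (v.adicCompletion k) c‖)
    {x : AtFin B v} (hx : c • x ∈ localOrder D v) : a • x ∈ localOrder D v := by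
  have h1 : a • x = (a / c) • c • x := by rw [smul_smul, div_mul_cancel₀ _ hc]
  rw [h1, ← algebraMap_smul_atFin (a / c)]
  refine smul_mem_localOrder ?_ hx
  rw [map_div₀, norm_div]
  exact div_le_one_of_le₀ h (norm_nonneg _)

theorem one_tmul_smul (a : k) (x : B) :
    (1 : v.adicCompletion k) ⊗ₜ[k] (a • x) = a • ((1 : v.adicCompletion k) ⊗ₜ[k] x) :=
  TensorProduct.tmul_smul _ _ _

/-- `B` is dense in its completions. -/
theorem IsOrder.exists_eq_tmul_add_smul (hD : IsOrder D) (z : AtFin B v) {r : 𝓞 k} (hr : r ≠ 0) :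
    ∃ y : B, ∃ w ∈ localOrder D v, z = (1 : v.adicCompletion k) ⊗ₜ[k] y + (r : k) • w := by
  have hr0 : (r : k) ≠ 0 := by simpa using hr
  have hr1 : algebraMap k (v.adicCompletion k) (r : k) ≠ 0 := by simpa using hr
  induction z using TensorProduct.induction_on with
  | zero => exact ⟨0, 0, zero_mem _, by simp⟩
  | add z₁ z₂ h₁ h₂ =>
    obtain ⟨y₁, w₁, hw₁, e₁⟩ := h₁
    obtain ⟨y₂, w₂, hw₂, e₂⟩ := h₂
    refine ⟨y₁ + y₂, w₁ + w₂, add_mem hw₁ hw₂, ?_⟩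
    rw [e₁, e₂, TensorProduct.tmul_add, smul_add]
    abel
  | tmul a x =>
    obtain ⟨s, hs, hsx⟩ := hD.exists_smul_mem x
    have hs0 : (s : k) ≠ 0 := by simpa using hs
    obtain ⟨y, hy⟩ := exists_norm_sub_le v (a * algebraMap k _ (s : k)⁻¹) (norm_pos_iff.mpr hr1)
    set e := a * algebraMap k _ (s : k)⁻¹ - algebraMap k _ y with he
    refine ⟨y • (s : k) • x, (e / algebraMap k _ (r : k)) ⊗ₜ ((s : k) • x),
      tmul_mem_localOrder ?_ hsx, ?_⟩
    · rw [norm_div]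
      exact div_le_one_of_le₀ hy (norm_nonneg _)
    · have h2 : ∀ (c : k) (b : v.adicCompletion k) (t : B),
          b ⊗ₜ[k] (c • t) = (algebraMap k (v.adicCompletion k) c * b) ⊗ₜ[k] t := fun c b t => by
        rw [TensorProduct.tmul_smul, TensorProduct.smul_tmul', Algebra.smul_def c b]
      rw [← TensorProduct.tmul_smul, h2 (r : k), mul_div_cancel₀ _ hr1, h2 y, mul_one,
        ← TensorProduct.add_tmul, he, add_sub_cancel, h2 (s : k), mul_left_comm, ← map_mul,
        mul_inv_cancel₀ hs0, map_one, mul_one]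

theorem IsOrder.exists_common_smul_mem (hD : IsOrder D) (T : Finset (HeightOneSpectrum (𝓞 k)))
    (z : (v : HeightOneSpectrum (𝓞 k)) → AtFin B v) :
    ∃ c : 𝓞 k, c ≠ 0 ∧ ∀ v ∈ T, (c : k) • z v ∈ localOrder D v := by
  classical
  choose c hc hcz using fun v => hD.exists_smul_mem_localOrder (z v)
  refine ⟨∏ v ∈ T, c v, Finset.prod_ne_zero_iff.mpr fun v _ => hc v, fun v hv => ?_⟩
  rw [← Finset.prod_erase_mul _ _ hv, coe_int_mul, mul_smul]
  exact int_smul_mem_localOrder _ (hcz v)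

/-- Approximate `α_{v₀}` by a global `y`, closely enough that `α_{v₀}⁻¹ y` is integral. Multiplying
`y` by an integer `b` near `1` at `v₀` and highly divisible elsewhere puts `b y` in `α D ⊆ D`; this
makes `y`, and then `α_{v₀}`, integral at `v₀`. -/
theorem IsOrder.mem_localOrder_of_mulOrder_le (hD : IsOrder D)
    (T : Finset (HeightOneSpectrum (𝓞 k))) {α : (v : HeightOneSpectrum (𝓞 k)) → (AtFin B v)ˣ}
    (hα : ∀ v ∉ T, α v = 1) (hle : mulOrder D α ≤ orderAddSubgroup D)
    (v₀ : HeightOneSpectrum (𝓞 k)) : (α v₀ : AtFin B v₀) ∈ localOrder D v₀ := by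
  obtain ⟨r, hr, hrα⟩ := hD.exists_smul_mem_localOrder
    (((α v₀)⁻¹ : (AtFin B v₀)ˣ) : AtFin B v₀)
  obtain ⟨y, w, hw, hyw⟩ := hD.exists_eq_tmul_add_smul (α v₀ : AtFin B v₀) hr
  let z : (v : HeightOneSpectrum (𝓞 k)) → AtFin B v := fun v =>
    (((α v)⁻¹ : (AtFin B v)ˣ) : AtFin B v) * ((1 : v.adicCompletion k) ⊗ₜ[k] y)
  have hz₀ : z v₀ ∈ localOrder D v₀ := by
    have h : z v₀ = 1 - ((r : k) • (((α v₀)⁻¹ : (AtFin B v₀)ˣ) : AtFin B v₀)) * w := by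
      have h1 : (1 : v₀.adicCompletion k) ⊗ₜ[k] y = (α v₀ : AtFin B v₀) - (r : k) • w := by
        rw [hyw, add_sub_cancel_right]
      simp only [z]
      rw [h1, mul_sub, Units.inv_mul, smul_mul_assoc, mul_smul_comm]
    rw [h]
    exact sub_mem (one_mem_localOrder D v₀) (mul_mem_localOrder hrα hw)
  obtain ⟨c₁, hc₁, hc₁y⟩ := hD.exists_smul_mem y
  -- The product `c₁ * c₂` clears the denominators of `y` and of `α_v⁻¹ y` at every finite place: on
  -- `T` by `c₂`, off `T` by `c₁`, since there `α_v = 1`.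
  obtain ⟨c₂, hc₂, hc₂z⟩ := hD.exists_common_smul_mem T z
  have hc : c₁ * c₂ ≠ 0 := mul_ne_zero hc₁ hc₂
  have hc0 : ((c₁ * c₂ : 𝓞 k) : k) ≠ 0 := by simpa using hc
  have hcy : ∀ v : HeightOneSpectrum (𝓞 k), ((c₁ * c₂ : 𝓞 k) : k) •
      ((1 : v.adicCompletion k) ⊗ₜ[k] y) ∈ localOrder D v := fun v => by
    rw [mul_comm, coe_int_mul, mul_smul, ← one_tmul_smul]
    exact int_smul_mem_localOrder _ (one_tmul_mem_localOrder v hc₁y)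
  have hcz : ∀ v, ((c₁ * c₂ : 𝓞 k) : k) • z v ∈ localOrder D v := by
    intro v
    by_cases hv : v ∈ T
    · rw [coe_int_mul, mul_smul]
      exact int_smul_mem_localOrder _ (hc₂z v hv)
    · simp only [z, hα v hv, inv_one, Units.val_one, one_mul]
      exact hcy v
  obtain ⟨b, hb, hb₀⟩ := exists_int_approx v₀ hc
  have hby : (b : k) • y ∈ D := by
    refine hle (mem_mulOrder_iff.mpr fun v => ?_)
    rw [one_tmul_smul, mul_smul_comm]
    by_cases hv : v = v₀
    · subst hv
      exact int_smul_mem_localOrder _ hz₀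
    · exact smul_mem_localOrder_of_norm_le hc0 (hb v hv) (hcz v)
  have hy : (1 : v₀.adicCompletion k) ⊗ₜ[k] y ∈ localOrder D v₀ := by
    have h : (1 : v₀.adicCompletion k) ⊗ₜ[k] y =
        (1 : v₀.adicCompletion k) ⊗ₜ[k] ((b : k) • y) +
          ((1 - b : 𝓞 k) : k) • ((1 : v₀.adicCompletion k) ⊗ₜ[k] y) := by
      rw [one_tmul_smul, ← add_smul]
      simp
    rw [h]
    exact add_mem (one_tmul_mem_localOrder v₀ hby)
      (smul_mem_localOrder_of_norm_le hc0 hb₀ (hcy v₀))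
  rw [hyw]
  exact add_mem hy (int_smul_mem_localOrder _ hw)

theorem mulOrder_le_of_mem_localOrder (hD : IsOrder D)
    {α : (v : HeightOneSpectrum (𝓞 k)) → (AtFin B v)ˣ}
    (hα : ∀ v, (α v : AtFin B v) ∈ localOrder D v) : mulOrder D α ≤ orderAddSubgroup D := by
  intro y hy
  refine mem_of_forall_mem_localOrder hD fun v => ?_
  have h := mul_mem_localOrder (hα v) (mem_mulOrder_iff.mp hy v)
  rwa [Units.mul_inv_cancel_left] at h

end MulOrder

/-! ### Bounding global indices by products of local ones. -/

section Index

/-- The index of an intersection is at most the product of the indices, and each preimage has index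
at most `[L i : H i]` because `K` maps into `L i`. Only upper bounds are used below, so strong
approximation is not required for the index. -/
theorem relIndex_iInf_comap_le {ι A : Type*} [AddCommGroup A] {M : ι → Type*}
    [∀ i, AddCommGroup (M i)] (f : ∀ i, A →+ M i) (H L : ∀ i, AddSubgroup (M i))
    (K : AddSubgroup A) (T : Finset ι) (hK : ∀ i ∈ T, K.map (f i) ≤ L i)
    (hH : ∀ i ∈ T, (H i).relIndex (L i) ≠ 0) :
    (⨅ i : T, (H i).comap (f i)).relIndex K ≠ 0 ∧
      (⨅ i : T, (H i).comap (f i)).relIndex K ≤ ∏ i ∈ T, (H i).relIndex (L i) := by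
  have h1 : ∀ i : T, ((H i).comap (f i)).relIndex K ≠ 0 := fun i => by
    rw [AddSubgroup.relIndex_comap]
    exact fun h => hH i i.2 (AddSubgroup.relIndex_eq_zero_of_le_right (hK i i.2) h)
  refine ⟨AddSubgroup.relIndex_iInf_ne_zero h1, ?_⟩
  refine (AddSubgroup.relIndex_iInf_le _).trans ?_
  rw [← Finset.prod_coe_sort T]
  refine Finset.prod_le_prod' fun i _ => ?_
  rw [AddSubgroup.relIndex_comap]
  exact AddSubgroup.relIndex_le_of_le_right (hK i i.2) (hH i i.2)

variable {k : Type*} [Field k] [NumberField k] {B : Type*} [DivisionRing B] [Algebra k B]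
  {D : Subalgebra (𝓞 k) B}

theorem map_orderAddSubgroup_le (v : HeightOneSpectrum (𝓞 k)) :
    (orderAddSubgroup D).map
      (Algebra.TensorProduct.includeRight : B →ₐ[k] AtFin B v).toRingHom.toAddMonoidHom ≤
      localOrder D v := by
  rintro _ ⟨x, hx, rfl⟩
  exact one_tmul_mem_localOrder v hx

theorem relIndex_mulOrder_le (hD : IsOrder D) (T : Finset (HeightOneSpectrum (𝓞 k)))
    {α : (v : HeightOneSpectrum (𝓞 k)) → (AtFin B v)ˣ} (hα : ∀ v ∉ T, α v = 1)
    (hmem : ∀ v, (α v : AtFin B v) ∈ localOrder D v) :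
    ((mulOrder D α).relIndex (orderAddSubgroup D) : ℝ) ≤
      ∏ v ∈ T, (absNormFin v (α v : AtFin B v))⁻¹ := by
  have hH : ∀ v ∈ T, ((localOrder D v).map (AddMonoidHom.mulLeft (α v : AtFin B v))).relIndex
      (localOrder D v) ≠ 0 := fun v _ h => by
    have h1 := relIndex_mulLeft hD (hmem v)
    rw [h, Nat.cast_zero] at h1
    exact (inv_pos.mpr (absNormFin_units_pos (α v))).ne h1
  have h := (relIndex_iInf_comap_le
    (fun v => (Algebra.TensorProduct.includeRight : B →ₐ[k] AtFin B v).toRingHom.toAddMonoidHom)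
    (fun v => (localOrder D v).map (AddMonoidHom.mulLeft (α v : AtFin B v))) (localOrder D)
    (orderAddSubgroup D) T (fun v _ => map_orderAddSubgroup_le v) hH)
  -- Off `T` the condition defining `α D` is integrality, already implied by membership in `D`;
  -- finitely many conditions remain.
  have hle : (⨅ v : T, ((localOrder D v.1).map (AddMonoidHom.mulLeft (α v : AtFin B v.1))).comap
      (Algebra.TensorProduct.includeRight : B →ₐ[k] AtFin B v.1).toRingHom.toAddMonoidHom) ⊓
      orderAddSubgroup D ≤ mulOrder D α := by
    rintro y ⟨hy, hyD⟩
    refine mem_mulOrder_iff.mpr fun v => ?_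
    by_cases hv : v ∈ T
    · obtain ⟨z, hz, hzy⟩ := (AddSubgroup.mem_iInf.mp hy) ⟨v, hv⟩
      have h1 : (1 : v.adicCompletion k) ⊗ₜ[k] y = (α v : AtFin B v) * z := hzy.symm
      rw [h1, Units.inv_mul_cancel_left]
      exact hz
    · rw [hα v hv, inv_one, Units.val_one, one_mul]
      exact one_tmul_mem_localOrder v hyD
  have h2 : (mulOrder D α).relIndex (orderAddSubgroup D) ≤
      ∏ v ∈ T, ((localOrder D v).map (AddMonoidHom.mulLeft (α v : AtFin B v))).relIndex
        (localOrder D v) := by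
    refine (AddSubgroup.relIndex_le_of_le_left hle ?_).trans ?_
    · rw [AddSubgroup.inf_relIndex_right]
      exact h.1
    · rw [AddSubgroup.inf_relIndex_right]
      exact h.2
  calc ((mulOrder D α).relIndex (orderAddSubgroup D) : ℝ) ≤ _ := Nat.cast_le.mpr h2
    _ = _ := by
      rw [Nat.cast_prod]
      exact Finset.prod_congr rfl fun v _ => relIndex_mulLeft hD (hmem v)

end Index

end DivAlg

noncomputable section
namespace DivAlg

/-! ### The product formula for norms from `B`. -/

section ProductFormula

variable {k : Type*} [Field k] [NumberField k] {B : Type*} [DivisionRing B] [Algebra k B]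
  {D : Subalgebra (𝓞 k) B}

theorem absNormInf_mul {w : InfinitePlace k} (x y : AtInf B w) :
    absNormInf w (x * y) = absNormInf w x * absNormInf w y := by
  rw [absNormInf, map_mul, norm_mul, mul_pow]; rfl

theorem absNormInf_nonneg {w : InfinitePlace k} (x : AtInf B w) : 0 ≤ absNormInf w x :=
  pow_nonneg (norm_nonneg _) _

variable [FiniteDimensional k B]

theorem absNormInf_one_tmul (w : InfinitePlace k) (x : B) :
    absNormInf w ((1 : w.Completion) ⊗ₜ[k] x) = w (Algebra.norm k x) ^ w.mult := by
  rw [absNormInf, norm_one_tmul]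
  congr 1
  exact InfinitePlace.Completion.norm_coe (v := w) _

theorem finite_absNormFin_ne_one {x : B} (hx : x ≠ 0) :
    {v : HeightOneSpectrum (𝓞 k) |
      absNormFin v ((1 : v.adicCompletion k) ⊗ₜ[k] x) ≠ 1}.Finite := by
  have h := FinitePlace.hasFiniteMulSupport (K := k) (x := Algebra.norm k x)
    (by rwa [Ne, Algebra.norm_eq_zero_iff])
  refine (h.preimage (FinitePlace.equivHeightOneSpectrum (K := k)).symm.injective.injOn).subset
    fun v hv => ?_
  rw [Set.mem_ofPred_eq, absNormFin_one_tmul] at hv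
  exact hv

/-- The product formula. -/
theorem prod_absNormInf_mul_prod_absNormFin {x : B} (hx : x ≠ 0)
    {T : Finset (HeightOneSpectrum (𝓞 k))}
    (hT : ∀ v ∉ T, absNormFin v ((1 : v.adicCompletion k) ⊗ₜ[k] x) = 1) :
    (∏ w : InfinitePlace k, absNormInf w ((1 : w.Completion) ⊗ₜ[k] x)) *
      ∏ v ∈ T, absNormFin v ((1 : v.adicCompletion k) ⊗ₜ[k] x) = 1 := by
  have h := NumberField.prod_abs_eq_one (K := k) (x := Algebra.norm k x)
    (by rwa [Ne, Algebra.norm_eq_zero_iff])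
  rw [← finprod_comp_equiv (FinitePlace.equivHeightOneSpectrum (K := k)).symm,
    finprod_eq_prod_of_mulSupport_subset (s := T)] at h
  · simp only [absNormInf_one_tmul, absNormFin_one_tmul]
    exact h
  · intro v hv
    by_contra hvT
    refine hv ?_
    have h1 := hT v hvT
    rw [absNormFin_one_tmul] at h1
    exact h1

end ProductFormula

/-! ### `S`-units and their norms. -/

section SUnits

variable {k : Type*} [Field k] [NumberField k] {B : Type*} [DivisionRing B] [Algebra k B]
  {D : Subalgebra (𝓞 k) B}

theorem mem_sUnits_iff (hD : IsOrder D) {S : Finset (HeightOneSpectrum (𝓞 k))} {γ : Bˣ} :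
    γ ∈ sUnits S D ↔ ∀ v ∉ S, (1 : v.adicCompletion k) ⊗ₜ[k] (γ : B) ∈ localOrder D v ∧
      (1 : v.adicCompletion k) ⊗ₜ[k] ((γ⁻¹ : Bˣ) : B) ∈ localOrder D v := by
  rw [sUnits, Submonoid.mem_units_iff]
  refine (and_congr (mem_sOrder_iff hD S) (mem_sOrder_iff hD S)).trans ?_
  exact ⟨fun h v hv => ⟨h.1 v hv, h.2 v hv⟩, fun h => ⟨fun v hv => (h v hv).1, fun v hv => (h v hv).2⟩⟩

/-- The image of a unit of `B` in a completion. -/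
def unitsAtFin (v : HeightOneSpectrum (𝓞 k)) : Bˣ →* (AtFin B v)ˣ :=
  Units.map (Algebra.TensorProduct.includeRight : B →ₐ[k] AtFin B v).toRingHom.toMonoidHom

theorem coe_unitsAtFin (v : HeightOneSpectrum (𝓞 k)) (γ : Bˣ) :
    (unitsAtFin v γ : AtFin B v) = (1 : v.adicCompletion k) ⊗ₜ[k] (γ : B) := rfl

theorem absNormFin_eq_one_of_mem_sUnits (hD : IsOrder D) {S : Finset (HeightOneSpectrum (𝓞 k))}
    {γ : Bˣ} (hγ : γ ∈ sUnits S D) {v : HeightOneSpectrum (𝓞 k)} (hv : v ∉ S) :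
    absNormFin v ((1 : v.adicCompletion k) ⊗ₜ[k] (γ : B)) = 1 := by
  obtain ⟨h1, h2⟩ := (mem_sUnits_iff hD).mp hγ v hv
  refine le_antisymm (absNormFin_le_one hD h1) ?_
  have h3 : absNormFin v (((unitsAtFin v γ)⁻¹ : (AtFin B v)ˣ) : AtFin B v) ≤ 1 := by
    rw [← map_inv]
    exact absNormFin_le_one hD h2
  rw [absNormFin_units_inv, inv_le_one₀ (absNormFin_units_pos (unitsAtFin v γ))] at h3
  exact h3

variable [FiniteDimensional k B]

theorem diag_mem_G (hD : IsOrder D) {S : Finset (HeightOneSpectrum (𝓞 k))} {γ : Bˣ}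
    (hγ : γ ∈ sUnits S D) : diag S γ ∈ G B S := by
  have h := prod_absNormInf_mul_prod_absNormFin γ.ne_zero (T := S)
    (fun v hv => absNormFin_eq_one_of_mem_sUnits hD hγ hv)
  rw [← Finset.prod_coe_sort S] at h
  exact eq_inv_of_mul_eq_one_left h

/-- Outside `S` the norms are at most `1` and, by the product formula, their product is at least `1
/ m`. A norm other than `1` at `v` would be at most `Norm(v)^(-d)`, which would force `Norm(v)^d ≤
m` and so `v ∈ S`. -/
theorem mem_sUnits_of_prod_le [Algebra.IsCentral k B] {d : ℕ} (hd : finrank k B = d ^ 2)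
    (hD : IsOrder D) {S : Finset (HeightOneSpectrum (𝓞 k))} {m : ℝ}
    (hS : ∀ v : HeightOneSpectrum (𝓞 k), (Ideal.absNorm v.asIdeal : ℝ) ^ d ≤ m → v ∈ S)
    {δ : Bˣ} (hδ : ∀ v ∉ S, (1 : v.adicCompletion k) ⊗ₜ[k] (δ : B) ∈ localOrder D v)
    (hm : (∏ w : InfinitePlace k, absNormInf w ((1 : w.Completion) ⊗ₜ[k] (δ : B))) *
      ∏ v ∈ S, absNormFin v ((1 : v.adicCompletion k) ⊗ₜ[k] (δ : B)) ≤ m) :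
    δ ∈ sUnits S D := by
  classical
  refine (mem_sUnits_iff hD).mpr fun v hv => ⟨hδ v hv, ?_⟩
  rw [← coe_unitsAtFin, map_inv]
  refine inv_mem_localOrder hD (hδ v hv) ?_
  let f : HeightOneSpectrum (𝓞 k) → ℝ := fun v =>
    absNormFin v ((1 : v.adicCompletion k) ⊗ₜ[k] (δ : B))
  -- The place `v` is inserted so that its factor occurs in the finite product even when it equals
  -- `1`.
  let T := insert v (finite_absNormFin_ne_one (k := k) δ.ne_zero).toFinset
  have hT : ∀ u ∉ S ∪ T, f u = 1 := fun u hu => by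
    by_contra hne
    refine hu (Finset.mem_union_right _ (Finset.mem_insert_of_mem ?_))
    exact (Set.Finite.mem_toFinset _).mpr hne
  have hprod := prod_absNormInf_mul_prod_absNormFin δ.ne_zero hT
  rw [← Finset.union_sdiff_self_eq_union, Finset.prod_union Finset.disjoint_sdiff,
    ← mul_assoc] at hprod
  have hvT : v ∈ T \ S := Finset.mem_sdiff.mpr ⟨Finset.mem_insert_self _ _, hv⟩
  have hle : ∏ u ∈ T \ S, f u ≤ f v := by
    rw [← Finset.mul_prod_erase _ _ hvT]
    refine mul_le_of_le_one_right (absNormFin_nonneg _) ?_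
    refine Finset.prod_le_one (fun u _ => absNormFin_nonneg _) fun u hu => ?_
    exact absNormFin_le_one hD (hδ u (Finset.mem_sdiff.mp (Finset.mem_of_mem_erase hu)).2)
  have hP : 0 ≤ ∏ u ∈ T \ S, f u := Finset.prod_nonneg fun u _ => absNormFin_nonneg _
  have hpos : 0 < f v := absNormFin_units_pos (unitsAtFin v δ)
  have h1 : 1 ≤ m * f v := by
    have hm0 : 0 ≤ m := le_trans (mul_nonneg (Finset.prod_nonneg fun w _ => absNormInf_nonneg _)
      (Finset.prod_nonneg fun u _ => absNormFin_nonneg _)) hm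
    calc (1 : ℝ) = _ := hprod.symm
      _ ≤ m * ∏ u ∈ T \ S, f u := mul_le_mul_of_nonneg_right hm hP
      _ ≤ m * f v := mul_le_mul_of_nonneg_left hle hm0
  have hd0 : d ≠ 0 := by
    rintro rfl
    exact (finrank_pos (R := k) (M := B)).ne' (by simpa using hd)
  -- The exponent `d` in the condition on `S` comes from here: `f v` is the `d`-th power of the
  -- discrete absolute value of the reduced norm `a`.
  obtain ⟨a, ha⟩ := exists_norm_eq_pow hd (δ : B)
  have hfa : f v = ‖algebraMap k (v.adicCompletion k) a‖ ^ d := by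
    simp only [f]
    rw [absNormFin_one_tmul, ha, map_pow, norm_algebraMap_eq_finitePlace]
  have hfle : f v ≤ 1 := absNormFin_le_one hD (hδ v hv)
  have ha1 : ‖algebraMap k (v.adicCompletion k) a‖ ≤ 1 := by
    rw [hfa] at hfle
    exact (pow_le_one_iff_of_nonneg (norm_nonneg _) hd0).mp hfle
  change f v = 1
  rw [hfa, norm_eq_one_of_inv_absNorm_lt v ha1 ?_, one_pow]
  by_contra hlt
  refine hv (hS v ?_)
  rw [not_lt] at hlt
  have hq : (0 : ℝ) < Ideal.absNorm v.asIdeal := by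
    exact_mod_cast zero_lt_one.trans (HeightOneSpectrum.one_lt_absNorm v)
  have h2 : f v ≤ ((Ideal.absNorm v.asIdeal : ℝ) ^ d)⁻¹ := by
    rw [hfa, ← inv_pow]
    exact pow_le_pow_left₀ (norm_nonneg _) hlt d
  have h3 := (pow_pos hq d)
  have hm0 : 0 < m := by
    by_contra hm0
    exact absurd h1 (not_le.mpr (lt_of_le_of_lt
      (mul_nonpos_of_nonpos_of_nonneg (not_lt.mp hm0) hpos.le) zero_lt_one))
  have h4 := h1.trans (mul_le_mul_of_nonneg_left h2 hm0.le)
  rwa [← div_eq_mul_inv, one_le_div h3] at h4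

end SUnits

/-! ### A local description of `F_X`. -/

section FundamentalSet

variable {k : Type*} [Field k] [NumberField k] {B : Type*} [DivisionRing B] [Algebra k B]
  {D : Subalgebra (𝓞 k) B}

theorem prod_rpow_mult_div {m : ℝ} (hm : 0 ≤ m) :
    ∏ v : InfinitePlace k, m ^ ((v.mult : ℝ) / (finrank ℚ k : ℝ)) = m := by
  rw [← Real.rpow_sum_of_nonneg hm fun v _ => by positivity, ← Finset.sum_div, ← Nat.cast_sum,
    InfinitePlace.sum_mult_eq, div_self (by exact_mod_cast (finrank_pos (R := ℚ) (M := k)).ne'),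
    Real.rpow_one]

theorem prod_absNormInf_le {m : ℝ} (hm : 0 ≤ m) {x : BR k B}
    (hx : ∀ v : InfinitePlace k,
      absNormInf v (x v) ≤ m ^ ((v.mult : ℝ) / (finrank ℚ k : ℝ))) :
    ∏ v : InfinitePlace k, absNormInf v (x v) ≤ m :=
  (Finset.prod_le_prod (fun _ _ => absNormInf_nonneg _) fun v _ => hx v).trans_eq
    (prod_rpow_mult_div hm)

theorem extendOne_of_notMem {S : Finset (HeightOneSpectrum (𝓞 k))}
    (β : (v : S) → (AtFin B v.1)ˣ) {v : HeightOneSpectrum (𝓞 k)} (hv : v ∉ S) :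
    extendOne β v = 1 := dif_neg hv

theorem extendOne_coe {S : Finset (HeightOneSpectrum (𝓞 k))}
    (β : (v : S) → (AtFin B v.1)ˣ) (v : S) : extendOne β v.1 = β v := dif_pos v.2

/-- The index condition is redundant: once all `β_v` are integral, `[D : β D]` is at most the
inverse of `∏ |Norm_v(β_v)|`, which on `G_S` equals `∏ |Norm_v(x_v)| ≤ m`. -/
theorem mem_F_iff (hD : IsOrder D) {X : Set (BR k B)} {m : ℝ} (hm : 0 ≤ m)
    (hXm : ∀ x ∈ X, ∀ v : InfinitePlace k,
      absNormInf v (x v) ≤ m ^ ((v.mult : ℝ) / (finrank ℚ k : ℝ)))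
    {S : Finset (HeightOneSpectrum (𝓞 k))} {g : BS B S} :
    g ∈ F S D X m ↔ g ∈ G B S ∧ (fun v => (g.1 v : AtInf B v)) ∈ X ∧
      ∀ v : S, (g.2 v : AtFin B v.1) ∈ localOrder D v.1 := by
  constructor
  · rintro ⟨hG, hX, hle, -⟩
    refine ⟨hG, hX, fun v => ?_⟩
    have h := hD.mem_localOrder_of_mulOrder_le S (fun v hv => extendOne_of_notMem g.2 hv) hle v.1
    rwa [extendOne_coe] at h
  · rintro ⟨hG, hX, hmem⟩
    have hmem' : ∀ v, (extendOne g.2 v : AtFin B v) ∈ localOrder D v := fun v => by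
      by_cases hv : v ∈ S
      · rw [extendOne_coe g.2 ⟨v, hv⟩]
        exact hmem ⟨v, hv⟩
      · rw [extendOne_of_notMem g.2 hv]
        exact one_mem_localOrder D v
    refine ⟨hG, hX, mulOrder_le_of_mem_localOrder hD hmem', ?_⟩
    refine (relIndex_mulOrder_le hD S (fun v hv => extendOne_of_notMem g.2 hv) hmem').trans ?_
    rw [← Finset.prod_coe_sort S]
    simp only [extendOne_coe]
    rw [Finset.prod_inv_distrib]
    exact (Eq.symm hG : _ = _).trans_le (prod_absNormInf_le hm (hXm _ hX))

/-- An element of `B` moving a point of `G_S` into `F_X` is an `S`-unit. -/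
theorem mem_sUnits_of_diag_mul_mem [Algebra.IsCentral k B] [FiniteDimensional k B] {d : ℕ}
    (hd : finrank k B = d ^ 2) (hD : IsOrder D) {m : ℝ} (hm : 0 ≤ m)
    {S : Finset (HeightOneSpectrum (𝓞 k))}
    (hS : ∀ v : HeightOneSpectrum (𝓞 k), (Ideal.absNorm v.asIdeal : ℝ) ^ d ≤ m → v ∈ S)
    {g : BS B S} (hg : g ∈ G B S) {δ : Bˣ}
    (hx : ∀ v : InfinitePlace k, absNormInf v ((1 : v.Completion) ⊗ₜ[k] (δ : B) *
      (g.1 v : AtInf B v)) ≤ m ^ ((v.mult : ℝ) / (finrank ℚ k : ℝ)))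
    (hβ : ∀ v : S, (1 : v.1.adicCompletion k) ⊗ₜ[k] (δ : B) * (g.2 v : AtFin B v.1) ∈
      localOrder D v.1)
    (hδ : ∀ v ∉ S, (1 : v.adicCompletion k) ⊗ₜ[k] (δ : B) ∈ localOrder D v) :
    δ ∈ sUnits S D := by
  refine mem_sUnits_of_prod_le hd hD hS hδ ?_
  have h1 := prod_absNormInf_le hm (x := fun v => (1 : v.Completion) ⊗ₜ[k] (δ : B) *
      (g.1 v : AtInf B v)) hx
  have h2 : ∏ v : S, absNormFin v.1 ((1 : v.1.adicCompletion k) ⊗ₜ[k] (δ : B) *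
      (g.2 v : AtFin B v.1)) ≤ 1 :=
    Finset.prod_le_one (fun v _ => absNormFin_nonneg _) fun v _ => absNormFin_le_one hD (hβ v)
  simp only [absNormInf_mul, absNormFin_mul, Finset.prod_mul_distrib] at h1 h2
  have hg' : ∏ v, absNormInf v (g.1 v : AtInf B v)
    = (∏ v, absNormFin v.1 (g.2 v : AtFin B v.1))⁻¹ := hg
  have hpos : 0 < ∏ v, absNormFin v.1 (g.2 v : AtFin B v.1) :=
    Finset.prod_pos fun v _ => absNormFin_units_pos _
  -- By the equation of `G_S`, the norms of `x` and of `β` cancel when the bounds for `δ x` and `δ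
  -- β` are multiplied.
  rw [hg', ← div_eq_mul_inv, div_le_iff₀ hpos] at h1
  rw [← Finset.prod_coe_sort S]
  have h0 : 0 ≤ ∏ v : S, absNormFin v.1 ((1 : v.1.adicCompletion k) ⊗ₜ[k] (δ : B)) :=
    Finset.prod_nonneg fun v _ => absNormFin_nonneg _
  calc _ ≤ (m * ∏ v, absNormFin v.1 (g.2 v : AtFin B v.1)) *
        ∏ v : S, absNormFin v.1 ((1 : v.1.adicCompletion k) ⊗ₜ[k] (δ : B)) :=
        mul_le_mul_of_nonneg_right h1 h0
    _ = m * ((∏ v : S, absNormFin v.1 ((1 : v.1.adicCompletion k) ⊗ₜ[k] (δ : B))) *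
        ∏ v, absNormFin v.1 (g.2 v : AtFin B v.1)) := by ring
    _ ≤ m * 1 := mul_le_mul_of_nonneg_left h2 hm
    _ = m := mul_one m

end FundamentalSet

end DivAlg

noncomputable section
namespace DivAlg

/-! ### Compact sets in unit groups of finite-dimensional algebras. -/

section ModuleTopology

variable (K : Type*) [Field K] [TopologicalSpace K] [IsTopologicalDivisionRing K]
  {A : Type*} [Ring A] [Algebra K A] [FiniteDimensional K A] [TopologicalSpace A]
  [IsModuleTopology K A]

include K in
theorem t2Space_of_isModuleTopology [T2Space K] : T2Space A :=
  T2Space.of_injective_continuous (f := (finBasis K A).equivFun)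
    (finBasis K A).equivFun.injective
    (IsModuleTopology.continuous_of_linearMap (finBasis K A).equivFun.toLinearMap)

theorem continuous_leftMulMatrix {n : Type*} [Fintype n] [DecidableEq n] (b : Basis n K A) :
    Continuous (Algebra.leftMulMatrix b) :=
  continuous_pi fun i => continuous_pi fun j => IsModuleTopology.continuous_of_linearMap
    (((Matrix.entryLinearMap K K i j) ∘ₗ (Algebra.leftMulMatrix b).toLinearMap : A →ₗ[K] K))

theorem continuous_algebraNorm : Continuous fun x : A => Algebra.norm K x := by
  simp only [Algebra.norm_eq_matrix_det (finBasis K A)]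
  exact (continuous_leftMulMatrix K (finBasis K A)).matrix_det

/-- In the unit group of a finite-dimensional algebra, a set is compact if it consists of the units
that lie in a given compact set and have norm in a given closed set avoiding zero. -/
theorem isCompact_units {C : Set A} (hC : IsCompact C) {E : Set K} (hE : IsClosed E)
    (h0 : (0 : K) ∉ E) : IsCompact {u : Aˣ | (u : A) ∈ C ∧ Algebra.norm K (u : A) ∈ E} := by
  have hadd : ContinuousAdd A := IsModuleTopology.toContinuousAdd K A
  let b := finBasis K A
  let M := Algebra.leftMulMatrix b
  have hN : ∀ x : A, Algebra.norm K x = (M x).det := Algebra.norm_eq_matrix_det b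
  let C' : Set A := C ∩ (fun x => Algebra.norm K x) ⁻¹' E
  have hC' : IsCompact C' := hC.inter_right (hE.preimage (continuous_algebraNorm K))
  have hne : ∀ x : C', (M (x : A)).det ≠ 0 := fun x h => by
    refine h0 ?_
    rw [← h, ← hN]
    exact x.2.2
  -- The topology of `Aˣ` also involves the inverse, so inversion must be continuous on `C'`.
  -- Cramer's rule gives `x⁻¹` as the solution of `x y = 1`, continuous where the determinant does
  -- not vanish.
  let inv : C' → A := fun x =>
    b.equivFun.symm ((M (x : A)).det⁻¹ • (M (x : A)).adjugate.mulVec (b.repr 1))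
  have hM : ∀ x : A, ∀ y : A, b.repr (x * y) = (M x).mulVec (b.repr y) := fun x y =>
    (Algebra.leftMulMatrix_mulVec_repr b x y).symm
  have h1 : ∀ x : C', (x : A) * inv x = 1 := fun x => by
    apply b.equivFun.injective
    rw [Basis.equivFun_apply, Basis.equivFun_apply, hM]
    have h2 : ⇑(b.repr (inv x)) =
        (M (x : A)).det⁻¹ • (M (x : A)).adjugate.mulVec (b.repr 1) := by
      rw [← Basis.equivFun_apply]
      exact b.equivFun.apply_symm_apply _
    rw [h2, Matrix.mulVec_smul, Matrix.mulVec_mulVec, Matrix.mul_adjugate, Matrix.smul_mulVec,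
      smul_smul, inv_mul_cancel₀ (hne x), one_smul, Matrix.one_mulVec]
  have h2 : ∀ x : C', inv x * (x : A) = 1 := fun x => by
    apply Algebra.leftMulMatrix_injective b
    have h3 : M (x : A) * M (inv x) = 1 := by rw [← map_mul, h1, map_one]
    rw [map_mul, map_one]
    exact mul_eq_one_comm.mp h3
  let f : C' → Aˣ := fun x => ⟨x, inv x, h1 x, h2 x⟩
  have hMc : Continuous fun x : C' => M (x : A) :=
    (continuous_leftMulMatrix K b).comp continuous_subtype_val
  have hinv : Continuous inv := by
    refine (IsModuleTopology.continuous_of_linearMap b.equivFun.symm.toLinearMap).comp ?_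
    exact (hMc.matrix_det.inv₀ hne).smul (hMc.matrix_adjugate.matrix_mulVec continuous_const)
  have hf : Continuous f := Units.continuous_iff.mpr ⟨continuous_subtype_val, hinv⟩
  have hrange : {u : Aˣ | (u : A) ∈ C ∧ Algebra.norm K (u : A) ∈ E} = Set.range f := by
    ext u
    constructor
    · intro hu
      exact ⟨⟨u, hu⟩, Units.ext rfl⟩
    · rintro ⟨x, rfl⟩
      exact x.2
  rw [hrange]
  have : CompactSpace C' := isCompact_iff_compactSpace.mp hC'
  exact isCompact_range hf

end ModuleTopology

/-! ### Compactness of `F_X`. -/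

section Compactness

variable {k : Type*} [Field k] [NumberField k] {B : Type*} [DivisionRing B] [Algebra k B]
  [FiniteDimensional k B] {D : Subalgebra (𝓞 k) B}

instance instT2SpaceAtInf (v : InfinitePlace k) : T2Space (AtInf B v) :=
  t2Space_of_isModuleTopology v.Completion

theorem IsOrder.isCompact_localOrder (hD : IsOrder D) (v : HeightOneSpectrum (𝓞 k)) :
    IsCompact (localOrder D v : Set (AtFin B v)) := by
  have hadd : ContinuousAdd (AtFin B v) := IsModuleTopology.toContinuousAdd (v.adicCompletion k) _
  obtain ⟨t, ht⟩ := (hD.isLattice v).fg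
  have h : (localOrder D v : Set (AtFin B v)) =
      (fun a : t → v.adicCompletion k => ∑ i, a i • (i : AtFin B v)) ''
        Set.pi Set.univ fun _ => {a | ‖a‖ ≤ 1} := by
    ext x
    rw [SetLike.mem_coe, ← mem_localLattice, ← ht]
    have hspan : Submodule.span (v.adicCompletionIntegers k) (t : Set (AtFin B v)) =
        Submodule.span (v.adicCompletionIntegers k) (Set.range fun i : t => (i : AtFin B v)) := by
      congr 1
      simp
    rw [hspan, Submodule.mem_span_range_iff_exists_fun]
    constructor
    · rintro ⟨c, rfl⟩
      exact ⟨fun i => c i, fun i _ => (norm_le_one_iff_mem v _).mpr (c i).2, rfl⟩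
    · rintro ⟨a, ha, rfl⟩
      exact ⟨fun i => ⟨a i, (norm_le_one_iff_mem v _).mp (ha i trivial)⟩, rfl⟩
  rw [h]
  refine (isCompact_univ_pi fun _ => isCompact_integers v).image ?_
  exact continuous_finsetSum _ fun i _ => (continuous_apply i).smul continuous_const

/-- The product of the factors other than `a i` is at most a power of `C`, so `a i` cannot be small.
-/
theorem le_of_prod_eq_one {ι : Type*} [Fintype ι] {a : ι → ℝ} {C : ℝ} (hC : 1 ≤ C)
    (ha0 : ∀ i, 0 ≤ a i) (haC : ∀ i, a i ≤ C) (h : ∏ i, a i = 1) (i : ι) :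
    (C ^ Fintype.card ι)⁻¹ ≤ a i := by
  classical
  rw [← Finset.mul_prod_erase _ _ (Finset.mem_univ i)] at h
  have h1 : ∏ j ∈ Finset.univ.erase i, a j ≤ C ^ Fintype.card ι := by
    refine (Finset.prod_le_prod (fun j _ => ha0 j) fun j _ => haC j).trans ?_
    rw [Finset.prod_const]
    exact pow_le_pow_right₀ hC (Finset.card_le_univ _)
  have hpos : 0 < C ^ Fintype.card ι := pow_pos (zero_lt_one.trans_le hC) _
  rw [inv_le_iff_one_le_mul₀ hpos]
  exact h.symm.le.trans (mul_le_mul_of_nonneg_left h1 (ha0 i))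

theorem continuous_absNormInf (v : InfinitePlace k) : Continuous (absNormInf (B := B) v) :=
  ((continuous_algebraNorm v.Completion).norm).pow _

theorem continuous_absNormFin (v : HeightOneSpectrum (𝓞 k)) :
    Continuous (absNormFin (B := B) v) :=
  (continuous_algebraNorm (v.adicCompletion k)).norm

theorem isCompact_F (hD : IsOrder D) {X : Set (BR k B)} (hX : IsCompact X) {m : ℝ} (hm : 0 ≤ m)
    (hXm : ∀ x ∈ X, ∀ v : InfinitePlace k,
      absNormInf v (x v) ≤ m ^ ((v.mult : ℝ) / (finrank ℚ k : ℝ)))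
    (S : Finset (HeightOneSpectrum (𝓞 k))) : IsCompact (F S D X m) := by
  -- A common upper bound for all norms on `F_X`; the summand `1` covers the finite places, and `c`
  -- below is the resulting lower bound.
  let C : ℝ := 1 + ∑ v : InfinitePlace k, m ^ ((v.mult : ℝ) / (finrank ℚ k : ℝ))
  have hnn : ∀ v : InfinitePlace k, 0 ≤ m ^ ((v.mult : ℝ) / (finrank ℚ k : ℝ)) := fun v =>
    Real.rpow_nonneg hm _
  have hC1 : 1 ≤ C := le_add_of_nonneg_right (Finset.sum_nonneg fun v _ => hnn v)
  have hCv : ∀ v : InfinitePlace k, m ^ ((v.mult : ℝ) / (finrank ℚ k : ℝ)) ≤ C := fun v =>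
    (Finset.single_le_sum (fun v _ => hnn v) (Finset.mem_univ v)).trans
      (le_add_of_nonneg_left zero_le_one)
  let c : ℝ := (C ^ Fintype.card (InfinitePlace k ⊕ S))⁻¹
  have hc : 0 < c := inv_pos.mpr (pow_pos (zero_lt_one.trans_le hC1) _)
  let Kinf : (v : InfinitePlace k) → Set (AtInf B v)ˣ := fun v =>
    {u | (u : AtInf B v) ∈ (fun x : BR k B => x v) '' X ∧
      Algebra.norm v.Completion (u : AtInf B v) ∈ {z : v.Completion | c ≤ ‖z‖ ^ v.mult}}
  let Kfin : (v : S) → Set (AtFin B v.1)ˣ := fun v =>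
    {u | (u : AtFin B v.1) ∈ (localOrder D v.1 : Set (AtFin B v.1)) ∧
      Algebra.norm (v.1.adicCompletion k) (u : AtFin B v.1) ∈
        {z : v.1.adicCompletion k | c ≤ ‖z‖}}
  have hKinf : ∀ v, IsCompact (Kinf v) := fun v => by
    refine isCompact_units v.Completion (hX.image (continuous_apply v))
      (isClosed_le continuous_const (continuous_norm.pow _)) ?_
    rw [Set.mem_ofPred_eq, norm_zero, zero_pow v.mult_pos.ne', not_le]
    exact hc
  have hKfin : ∀ v, IsCompact (Kfin v) := fun v => by
    refine isCompact_units (v.1.adicCompletion k) (hD.isCompact_localOrder v.1)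
      (isClosed_le continuous_const continuous_norm) ?_
    rw [Set.mem_ofPred_eq, norm_zero, not_le]
    exact hc
  have hK : IsCompact (Set.pi Set.univ Kinf ×ˢ Set.pi Set.univ Kfin) :=
    (isCompact_univ_pi hKinf).prod (isCompact_univ_pi hKfin)
  have hcinf : ∀ v : InfinitePlace k, Continuous fun g : BS B S => (g.1 v : AtInf B v) :=
    fun v => Units.continuous_val.comp ((continuous_apply v).comp continuous_fst)
  have hcfin : ∀ v : S, Continuous fun g : BS B S => (g.2 v : AtFin B v.1) :=
    fun v => Units.continuous_val.comp ((continuous_apply v).comp continuous_snd)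
  have hclosed : IsClosed {g : BS B S |
      (∏ v, absNormInf v (g.1 v : AtInf B v)) * ∏ v, absNormFin v.1 (g.2 v : AtFin B v.1) = 1 ∧
      (fun v => (g.1 v : AtInf B v)) ∈ X} := by
    refine IsClosed.inter (isClosed_eq (Continuous.mul ?_ ?_) continuous_const)
      (hX.isClosed.preimage (continuous_pi hcinf))
    · exact continuous_finsetProd _ fun v _ => (continuous_absNormInf v).comp (hcinf v)
    · exact continuous_finsetProd _ fun v _ => (continuous_absNormFin v.1).comp (hcfin v)
  have hF : F S D X m = (Set.pi Set.univ Kinf ×ˢ Set.pi Set.univ Kfin) ∩ {g : BS B S |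
      (∏ v, absNormInf v (g.1 v : AtInf B v)) * ∏ v, absNormFin v.1 (g.2 v : AtFin B v.1) = 1 ∧
      (fun v => (g.1 v : AtInf B v)) ∈ X} := by
    ext g
    have hG : g ∈ G B S ↔ (∏ v, absNormInf v (g.1 v : AtInf B v)) *
        ∏ v, absNormFin v.1 (g.2 v : AtFin B v.1) = 1 := by
      refine (mul_eq_one_iff_eq_inv₀ ?_).symm
      exact (Finset.prod_pos fun v _ => absNormFin_units_pos _).ne'
    rw [mem_F_iff hD hm hXm, hG]
    constructor
    · rintro ⟨h1, h2, h3⟩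
      let a : InfinitePlace k ⊕ S → ℝ := Sum.elim
        (fun v => absNormInf v (g.1 v : AtInf B v)) fun v => absNormFin v.1 (g.2 v : AtFin B v.1)
      have ha : ∏ i, a i = 1 := by rw [Fintype.prod_sum_type]; exact h1
      have hac := le_of_prod_eq_one hC1
        (by rintro (v | v); exacts [absNormInf_nonneg _, absNormFin_nonneg _])
        (by
          rintro (v | v)
          exacts [(hXm _ h2 v).trans (hCv v), (absNormFin_le_one hD (h3 v)).trans hC1]) ha
      exact ⟨⟨fun v _ => ⟨⟨_, h2, rfl⟩, hac (Sum.inl v)⟩, fun v _ => ⟨h3 v, hac (Sum.inr v)⟩⟩,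
        h1, h2⟩
    · rintro ⟨⟨-, h3⟩, h1, h2⟩
      exact ⟨h1, h2, fun v => (h3 v trivial).1⟩
  rw [hF]
  exact hK.inter_right hclosed

end Compactness

end DivAlg

noncomputable section
namespace DivAlg

/-! ### Archimedean completions as real algebras. -/

section RealCompletion

variable {k : Type*} [Field k] {v : InfinitePlace k}

theorem algebraMap_completion (r : ℝ) : algebraMap ℝ v.Completion r = realToCompletion v r := rfl

/-- The completion at a real place is isomorphic to `ℝ` as an `ℝ`-algebra. -/
def algEquivRealOfIsReal (h : v.IsReal) : v.Completion ≃ₐ[ℝ] ℝ :=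
  AlgEquiv.ofRingEquiv (f := InfinitePlace.Completion.ringEquivRealOfIsReal h) fun r => by
    rw [algebraMap_completion, realToCompletion, dif_pos h]
    exact (InfinitePlace.Completion.ringEquivRealOfIsReal h).apply_symm_apply r

/-- The completion at a complex place is isomorphic to `ℂ` as an `ℝ`-algebra. -/
def algEquivComplexOfIsComplex (h : v.IsComplex) : v.Completion ≃ₐ[ℝ] ℂ :=
  AlgEquiv.ofRingEquiv (f := InfinitePlace.Completion.ringEquivComplexOfIsComplex h) fun r => by
    rw [algebraMap_completion, realToCompletion,
      dif_neg (InfinitePlace.not_isReal_iff_isComplex.mpr h)]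
    exact (InfinitePlace.Completion.ringEquivComplexOfIsComplex h).apply_symm_apply _

theorem norm_algEquivRealOfIsReal (h : v.IsReal) (a : v.Completion) :
    ‖algEquivRealOfIsReal h a‖ = ‖a‖ :=
  (AddMonoidHomClass.isometry_iff_norm (InfinitePlace.Completion.ringEquivRealOfIsReal h)).mp
    (InfinitePlace.Completion.isometryEquivRealOfIsReal h).isometry a

theorem norm_algEquivComplexOfIsComplex (h : v.IsComplex) (a : v.Completion) :
    ‖algEquivComplexOfIsComplex h a‖ = ‖a‖ :=
  (AddMonoidHomClass.isometry_iff_norm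
    (InfinitePlace.Completion.ringEquivComplexOfIsComplex h)).mp
    (InfinitePlace.Completion.isometryEquivComplexOfIsComplex h).isometry a

theorem abs_norm_completion (a : v.Completion) : |Algebra.norm ℝ a| = ‖a‖ ^ v.mult := by
  by_cases h : v.IsReal
  · rw [← Algebra.norm_eq_of_algEquiv (algEquivRealOfIsReal h), Algebra.norm_self,
      InfinitePlace.mult, if_pos h, pow_one, ← norm_algEquivRealOfIsReal h a, Real.norm_eq_abs]
    rfl
  · have h' := InfinitePlace.not_isReal_iff_isComplex.mp h
    rw [← Algebra.norm_eq_of_algEquiv (algEquivComplexOfIsComplex h'),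
      Algebra.norm_complex_apply, InfinitePlace.mult, if_neg h,
      ← norm_algEquivComplexOfIsComplex h' a, Complex.normSq_eq_norm_sq, abs_of_nonneg (by positivity)]

theorem finrank_completion : finrank ℝ v.Completion = v.mult := by
  by_cases h : v.IsReal
  · rw [(algEquivRealOfIsReal h).toLinearEquiv.finrank_eq, finrank_self, InfinitePlace.mult,
      if_pos h]
  · rw [(algEquivComplexOfIsComplex
      (InfinitePlace.not_isReal_iff_isComplex.mp h)).toLinearEquiv.finrank_eq,
      Complex.finrank_real_complex, InfinitePlace.mult, if_neg h]

theorem continuous_algebraMap_completion : Continuous (algebraMap ℝ v.Completion) := by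
  refine AddMonoidHomClass.continuous_of_bound (algebraMap ℝ v.Completion) 1 fun r => ?_
  rw [one_mul]
  by_cases h : v.IsReal
  · rw [← norm_algEquivRealOfIsReal h, AlgEquiv.commutes]
    rfl
  · rw [← norm_algEquivComplexOfIsComplex (InfinitePlace.not_isReal_iff_isComplex.mp h),
      AlgEquiv.commutes]
    exact (Complex.norm_real r).le

instance instContinuousSMulCompletion : ContinuousSMul ℝ v.Completion :=
  continuousSMul_of_algebraMap ℝ _ continuous_algebraMap_completion

end RealCompletion

/-! ### The real algebra `B_ℝ` and the lattice `D` in it. -/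

section RealAlgebra

variable {k : Type*} [Field k] [NumberField k] {B : Type*} [DivisionRing B] [Algebra k B]
  [FiniteDimensional k B]

instance instContinuousSMulAtInf (v : InfinitePlace k) : ContinuousSMul ℝ (AtInf B v) where
  continuous_smul := by
    have h : (fun p : ℝ × AtInf B v => p.1 • p.2) =
        fun p => (algebraMap ℝ v.Completion p.1) • p.2 := by
      ext p
      rw [algebraMap_smul]
    rw [h]
    have h1 : Continuous fun p : ℝ × AtInf B v => algebraMap ℝ v.Completion p.1 :=
      continuous_algebraMap_completion.comp continuous_fst
    exact h1.smul continuous_snd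

instance instContinuousAddAtInf (v : InfinitePlace k) : ContinuousAdd (AtInf B v) :=
  IsModuleTopology.toContinuousAdd v.Completion _

instance instIsTopologicalAddGroupAtInf (v : InfinitePlace k) :
    IsTopologicalAddGroup (AtInf B v) where
  continuous_neg := by
    have h : (fun x : AtInf B v => -x) = fun x => (-1 : v.Completion) • x :=
      funext fun x => (neg_one_smul v.Completion x).symm
    rw [h]
    exact continuous_const_smul _

variable (k B) in
theorem finrank_BR : finrank ℝ (BR k B) = finrank ℚ k * finrank k B := by
  rw [Module.finrank_pi_fintype, ← InfinitePlace.sum_mult_eq, Finset.sum_mul]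
  refine Finset.sum_congr rfl fun v _ => ?_
  rw [← Module.finrank_mul_finrank ℝ v.Completion, finrank_baseChange, finrank_completion]

theorem toBR_add (x y : B) : (toBR (x + y) : BR k B) = toBR x + toBR y :=
  funext fun _ => TensorProduct.tmul_add _ _ _

variable (k B) in
/-- The diagonal embedding as an additive homomorphism. -/
def toBRHom : B →+ BR k B where
  toFun := toBR
  map_zero' := funext fun _ => TensorProduct.tmul_zero _ _
  map_add' := toBR_add

/-- The image of a full lattice of `B` spans `B_ℝ`. -/
theorem span_toBR_eq_top {D : Subalgebra (𝓞 k) B} (hD : IsOrder D) {ι : Type*}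
    (ω : Basis ι ℤ D) :
    Submodule.span ℝ (Set.range fun i => (toBR (ω i : B) : BR k B)) = ⊤ := by
  classical
  set V := Submodule.span ℝ (Set.range fun i => (toBR (ω i : B) : BR k B)) with hV
  have hVD : ∀ x ∈ D, (toBR x : BR k B) ∈ V := by
    intro x hx
    have h := ω.mem_span ⟨x, hx⟩
    refine Submodule.span_induction (p := fun (y : D) _ => (toBR (y : B) : BR k B) ∈ V) ?_ ?_ ?_ ?_ h
    · rintro _ ⟨i, rfl⟩
      exact Submodule.subset_span ⟨i, rfl⟩
    · have h1 : (toBR ((0 : D) : B) : BR k B) = 0 := map_zero (toBRHom k B)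
      rw [h1]
      exact V.zero_mem
    · intro y z _ _ hy hz
      have h1 : (toBR ((y + z : D) : B) : BR k B) = toBR (y : B) + toBR (z : B) := toBR_add _ _
      rw [h1]
      exact V.add_mem hy hz
    · intro n y _ hy
      have h1 : (toBR ((n • y : D) : B) : BR k B) = n • toBR (y : B) :=
        map_zsmul (toBRHom k B) n (y : B)
      rw [h1]
      exact zsmul_mem hy n
  have hVB : ∀ x : B, (toBR x : BR k B) ∈ V := by
    intro x
    obtain ⟨r, hr, hrx⟩ := hD.exists_smul_mem x
    -- `V` is only a real subspace, so the denominator `r` is replaced by a rational integer, the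
    -- norm of `(r)`, by which one can divide in `V`.
    obtain ⟨s, hs⟩ := Ideal.mem_span_singleton'.mp (Ideal.absNorm_mem (Ideal.span {r}))
    have hn : (Ideal.absNorm (Ideal.span {r}) : ℝ) ≠ 0 := by
      rw [Nat.cast_ne_zero, Ne, Ideal.absNorm_eq_zero_iff, Ideal.span_singleton_eq_bot]
      exact hr
    have h1 : (Ideal.absNorm (Ideal.span {r})) • x ∈ D := by
      have h2 : (Ideal.absNorm (Ideal.span {r})) • x = (s : k) • (r : k) • x := by
        rw [smul_smul, ← coe_int_mul, hs, ← Nat.cast_smul_eq_nsmul k]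
        simp
      rw [h2]
      have h3 : (s : k) • (r : k) • x = s • ((r : k) • x) := algebraMap_smul k s ((r : k) • x)
      rw [h3]
      exact D.smul_mem hrx s
    have h2 := hVD _ h1
    have h3 : (toBR (Ideal.absNorm (Ideal.span {r}) • x) : BR k B) =
        (Ideal.absNorm (Ideal.span {r}) : ℝ) • toBR x := by
      rw [Nat.cast_smul_eq_nsmul]
      exact map_nsmul (toBRHom k B) _ x
    rw [h3] at h2
    exact (V.smul_mem_iff hn).mp h2
  -- Since `V` is closed and `k` is dense in the product of its archimedean completions, `V`
  -- contains every `(a_v ⊗ x)_v`, and these span `B_ℝ`.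
  have hclosed : IsClosed (V : Set (BR k B)) := V.closed_of_finiteDimensional
  have hpi : ∀ (a : (v : InfinitePlace k) → v.Completion) (x : B),
      (fun v => a v ⊗ₜ[k] x : BR k B) ∈ V := by
    intro a x
    have hcont : Continuous fun a : InfiniteAdeleRing k => (fun v => a v ⊗ₜ[k] x : BR k B) := by
      refine continuous_pi fun v => ?_
      have h1 : Continuous fun b : v.Completion => (b ⊗ₜ[k] x : AtInf B v) := by
        have h2 : (fun b : v.Completion => (b ⊗ₜ[k] x : AtInf B v)) =
            fun b => b • ((1 : v.Completion) ⊗ₜ[k] x) := by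
          funext b
          rw [TensorProduct.smul_tmul', smul_eq_mul, mul_one]
        rw [h2]
        have h3 : Continuous fun b : v.Completion => b := continuous_id
        have h4 : Continuous fun _ : v.Completion =>
          ((1 : v.Completion) ⊗ₜ[k] x : AtInf B v) := continuous_const
        exact h3.smul h4
      have h3 : Continuous fun a : InfiniteAdeleRing k => a v := continuous_apply v
      exact h1.comp h3
    refine (InfiniteAdeleRing.denseRange_algebraMap k).induction_on
      (p := fun a : InfiniteAdeleRing k => (fun v => a v ⊗ₜ[k] x : BR k B) ∈ V) a
      (hclosed.preimage hcont) fun c => ?_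
    have h1 := hVB (c • x)
    have h2 : (toBR (c • x) : BR k B) = fun v => (algebraMap k (InfiniteAdeleRing k) c) v ⊗ₜ[k] x := by
      funext v
      simp only [toBR]
      rw [TensorProduct.tmul_smul, TensorProduct.smul_tmul', Algebra.smul_def c, mul_one]
      rfl
    rwa [h2] at h1
  rw [eq_top_iff]
  intro x _
  rw [← Finset.univ_sum_single x]
  refine V.sum_mem fun v _ => ?_
  generalize x v = z
  induction z using TensorProduct.induction_on with
  | zero => rw [Pi.single_zero]; exact V.zero_mem
  | add y z hy hz => rw [Pi.single_add]; exact V.add_mem hy hz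
  | tmul a y =>
    convert hpi (Pi.single v a) y using 1
    funext w
    by_cases hw : w = v
    · subst hw; simp
    · simp [Pi.single_eq_of_ne hw]

end RealAlgebra

end DivAlg

noncomputable section
namespace DivAlg

/-! ### The trace form, its nondegeneracy and change of basis. -/

section TraceForm

/-- The trace form of the base change of a central division algebra is nondegenerate. -/
theorem eq_zero_of_trace_mul_eq_zero {k B : Type*} [Field k] [CharZero k] [DivisionRing B]
    [Algebra k B] [Algebra.IsCentral k B] [FiniteDimensional k B] (K : Type*) [Field K]
    [Algebra k K] {x : K ⊗[k] B}
    (hx : ∀ y, LinearMap.trace K (K ⊗[k] B) (LinearMap.mulLeft K (x * y)) = 0) : x = 0 := by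
  have hmul : ∀ a b : K ⊗[k] B, LinearMap.mulLeft K (a * b) =
      LinearMap.mulLeft K a * LinearMap.mulLeft K b := fun a b =>
    LinearMap.ext fun z => mul_assoc a b z
  have hadd : ∀ a b : K ⊗[k] B, LinearMap.mulLeft K (a + b) =
      LinearMap.mulLeft K a + LinearMap.mulLeft K b := fun a b =>
    LinearMap.ext fun z => add_mul a b z
  have hsimple := isSimpleRing_tensorProduct k K B
  -- The radical of the trace form is a two-sided ideal of a simple ring. It is not everything,
  -- since the trace of the identity is `dim B ≠ 0`.
  let I : TwoSidedIdeal (K ⊗[k] B) := TwoSidedIdeal.mk'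
    {x | ∀ y, LinearMap.trace K (K ⊗[k] B) (LinearMap.mulLeft K (x * y)) = 0}
    (fun y => by rw [zero_mul, LinearMap.mulLeft_zero_eq_zero, map_zero])
    (fun {a b} ha hb y => by rw [add_mul, hadd, map_add, ha y, hb y, add_zero])
    (fun {a} ha y => by rw [neg_mul_comm]; exact ha _)
    (fun {a b} hb y => by
      rw [mul_assoc, hmul, LinearMap.trace_mul_comm, ← hmul, mul_assoc]
      exact hb _)
    (fun {a b} ha y => by rw [mul_assoc]; exact ha _)
  have hxI : x ∈ I := (TwoSidedIdeal.mem_mk' _ _ _ _ _ _ x).mpr hx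
  rcases eq_bot_or_eq_top I with h | h
  · rwa [h, TwoSidedIdeal.mem_bot] at hxI
  · exfalso
    have h1 : (1 : K ⊗[k] B) ∈ I := h ▸ trivial
    have h2 := (TwoSidedIdeal.mem_mk' _ _ _ _ _ _ 1).mp h1 1
    rw [mul_one, LinearMap.mulLeft_one, LinearMap.trace_id, finrank_baseChange] at h2
    have : CharZero K := charZero_of_injective_algebraMap (algebraMap k K).injective
    exact (finrank_pos (R := k) (M := B)).ne' (by exact_mod_cast h2)

variable {k : Type*} [Field k] [NumberField k] {B : Type*} [DivisionRing B] [Algebra k B]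

theorem traceR_add (d : ℕ) (x y : BR k B) : traceR d (x + y) = traceR d x + traceR d y := by
  simp only [traceR, ← Finset.sum_add_distrib]
  refine Finset.sum_congr rfl fun v _ => ?_
  have h : LinearMap.mulLeft v.Completion ((x + y) v) =
      LinearMap.mulLeft v.Completion (x v) + LinearMap.mulLeft v.Completion (y v) :=
    LinearMap.ext fun z => add_mul (x v) (y v) z
  rw [h, map_add, mul_add, map_add]

theorem traceR_smul (d : ℕ) (r : ℝ) (x : BR k B) : traceR d (r • x) = r • traceR d x := by
  simp only [traceR, Finset.smul_sum]
  refine Finset.sum_congr rfl fun v _ => ?_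
  have h : LinearMap.mulLeft v.Completion ((r • x) v) =
      (algebraMap ℝ v.Completion r) • LinearMap.mulLeft v.Completion (x v) := by
    refine LinearMap.ext fun z => ?_
    rw [LinearMap.smul_apply, algebraMap_smul]
    exact smul_mul_assoc r (x v) z
  rw [h, map_smul, smul_eq_mul, mul_left_comm, ← Algebra.smul_def, map_smul]

theorem traceR_mul_comm (d : ℕ) (x y : BR k B) : traceR d (x * y) = traceR d (y * x) := by
  simp only [traceR]
  refine Finset.sum_congr rfl fun v _ => ?_
  rw [Pi.mul_apply, Pi.mul_apply, LinearMap.mulLeft_mul, LinearMap.mulLeft_mul]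
  congr 2
  exact LinearMap.trace_mul_comm _ _ _

variable (k B) in
/-- The trace form `T(xy)` on `B_ℝ`. -/
def traceFormR (d : ℕ) : LinearMap.BilinForm ℝ (BR k B) :=
  LinearMap.mk₂ ℝ (fun x y => traceR d (x * y))
    (fun x y z => by rw [add_mul, traceR_add])
    (fun r x y => by rw [smul_mul_assoc, traceR_smul])
    (fun x y z => by rw [mul_add, traceR_add])
    (fun r x y => by rw [mul_smul_comm, traceR_smul])

theorem toMatrix_traceFormR (d : ℕ) {ι : Type*} [Fintype ι] [DecidableEq ι]
    (b : Basis ι ℝ (BR k B)) :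
    LinearMap.BilinForm.toMatrix b (traceFormR k B d) =
      Matrix.of fun i j => traceR d (b i * b j) := by
  ext i j
  rw [LinearMap.BilinForm.toMatrix_apply]
  rfl

/-- The Gram matrix changes to `Pᵀ G P`. Thus `d_D` and `Vol` are the same constant times Lebesgue
quantities in fixed coordinates. -/
theorem rootGram_eq_abs_det_mul (d : ℕ) {ι : Type*} [Fintype ι] [DecidableEq ι]
    (b c : Basis ι ℝ (BR k B)) : rootGram d c = |b.det c| * rootGram d b := by
  rw [rootGram, rootGram, ← toMatrix_traceFormR, ← toMatrix_traceFormR,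
    ← LinearMap.BilinForm.toMatrix_mul_basis_toMatrix b c, Matrix.det_mul, Matrix.det_mul,
    Matrix.det_transpose, ← Basis.det_apply, mul_right_comm, abs_mul,
    Real.sqrt_mul (abs_nonneg _), abs_mul, Real.sqrt_mul_self (abs_nonneg _)]

variable [Algebra.IsCentral k B] [FiniteDimensional k B]

theorem traceFormR_nondegenerate {d : ℕ} (hd : d ≠ 0) : (traceFormR k B d).Nondegenerate := by
  classical
  have h : ∀ x : BR k B, (∀ y, traceR d (x * y) = 0) → x = 0 := by
    intro x hx
    funext v
    refine eq_zero_of_trace_mul_eq_zero v.Completion fun y => ?_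
    by_contra ht
    set t := LinearMap.trace v.Completion (AtInf B v) (LinearMap.mulLeft v.Completion (x v * y))
    have hd0 : (d : v.Completion) ≠ 0 := by
      have : CharZero v.Completion :=
        charZero_of_injective_algebraMap (algebraMap k v.Completion).injective
      exact Nat.cast_ne_zero.mpr hd
    -- Scaled so that the reduced trace of the product at `v` is `1`; its trace to `ℝ` is then `[k_v
    -- : ℝ] ≠ 0`.
    have h1 := hx (Pi.single v (((d : v.Completion) * t⁻¹) • y))
    rw [traceR, Finset.sum_eq_single v] at h1
    · rw [Pi.mul_apply, Pi.single_eq_same, mul_smul_comm] at h1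
      have h2 : LinearMap.mulLeft v.Completion (((d : v.Completion) * t⁻¹) • (x v * y)) =
          ((d : v.Completion) * t⁻¹) • LinearMap.mulLeft v.Completion (x v * y) :=
        LinearMap.ext fun z => smul_mul_assoc _ (x v * y) z
      have h3 : (d : v.Completion)⁻¹ * ((d : v.Completion) * t⁻¹ * t) = 1 := by
        rw [mul_assoc, inv_mul_cancel₀ ht, mul_one, inv_mul_cancel₀ hd0]
      rw [h2, map_smul, smul_eq_mul] at h1
      change Algebra.trace ℝ v.Completion ((d : v.Completion)⁻¹ * ((d : v.Completion) * t⁻¹ * t)) = 0 at h1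
      rw [h3, ← map_one (algebraMap ℝ v.Completion), Algebra.trace_algebraMap,
        finrank_completion] at h1
      simp [v.mult_pos.ne'] at h1
    · intro w _ hw
      rw [Pi.mul_apply, Pi.single_eq_of_ne hw, mul_zero, LinearMap.mulLeft_zero_eq_zero, map_zero,
        mul_zero, map_zero]
    · exact fun hv => absurd (Finset.mem_univ v) hv
  refine ⟨fun x hx => h x hx, fun y hy => h y fun x => ?_⟩
  rw [traceR_mul_comm]
  exact hy x

/-- Positivity allows the Gram factor to be cancelled from both sides of the volume hypothesis. -/
theorem rootGram_pos {d : ℕ} (hd : d ≠ 0) {ι : Type*} [Fintype ι] [DecidableEq ι]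
    (b : Basis ι ℝ (BR k B)) : 0 < rootGram d b := by
  rw [rootGram, Real.sqrt_pos, abs_pos, ← toMatrix_traceFormR]
  exact (LinearMap.BilinForm.nondegenerate_iff_det_ne_zero b).mp (traceFormR_nondegenerate hd)

end TraceForm

/-! ### A `ℤ`-basis of `D` as a real basis, and the volume hypothesis. -/

section RealBasis

variable {k : Type*} [Field k] [NumberField k] {B : Type*} [DivisionRing B] [Algebra k B]
  [FiniteDimensional k B] {D : Subalgebra (𝓞 k) B} {ι : Type*} [Fintype ι]

/-- Independence over `ℤ`, hence over `ℚ`, gives one inequality; spanning `B_ℝ` gives the other. -/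
theorem IsOrder.card_eq_finrank (hD : IsOrder D) (ω : Basis ι ℤ D) :
    Fintype.card ι = finrank ℝ (BR k B) := by
  classical
  apply le_antisymm
  · have : CharZero B := charZero_of_injective_algebraMap (algebraMap k B).injective
    have hfin : Module.Finite ℚ B := Module.Finite.trans k B
    rw [finrank_BR, Module.finrank_mul_finrank]
    have h : LinearIndependent ℤ fun i => (ω i : B) :=
      ω.linearIndependent.map' (Subalgebra.toSubmodule D).subtype.toAddMonoidHom.toIntLinearMap
        (LinearMap.ker_eq_bot.mpr Subtype.val_injective)
    exact ((LinearIndependent.iff_fractionRing ℤ ℚ).mp h).fintype_card_le_finrank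
  · have h := finrank_range_le_card (R := ℝ) fun i => (toBR (ω i : B) : BR k B)
    rwa [Set.finrank, span_toBR_eq_top hD, finrank_top] at h

/-- A `ℤ`-basis of an order is an `ℝ`-basis of `B_ℝ`. -/
def IsOrder.realBasis (hD : IsOrder D) (ω : Basis ι ℤ D) : Basis ι ℝ (BR k B) :=
  basisOfTopLeSpanOfCardEqFinrank (fun i => toBR (ω i : B)) (span_toBR_eq_top hD ω).ge
    (hD.card_eq_finrank ω)

theorem IsOrder.realBasis_apply (hD : IsOrder D) (ω : Basis ι ℤ D) (i : ι) :
    hD.realBasis ω i = toBR (ω i : B) := by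
  rw [IsOrder.realBasis, coe_basisOfTopLeSpanOfCardEqFinrank]

theorem rootGram_comp_equiv (d : ℕ) {κ : Type*} [Fintype κ] [DecidableEq ι] [DecidableEq κ]
    (e : κ ≃ ι) (b : ι → BR k B) : rootGram d (b ∘ e) = rootGram d b := by
  rw [rootGram, rootGram, ← Matrix.det_submatrix_equiv_self e (Matrix.of fun i j => _)]
  rfl

/-- The volume hypothesis in terms of Lebesgue measure. -/
theorem two_pow_mul_le_volume [Algebra.IsCentral k B] [DecidableEq ι] {d : ℕ} (hd : d ≠ 0)
    (hD : IsOrder D) (ω : Basis ι ℤ D)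
    (P : Basis (Fin (finrank ℝ (BR k B))) ℝ (BR k B)) (e : Fin (finrank ℝ (BR k B)) ≃ ι)
    (hP : ∀ i, P i = toBR (ω (e i) : B)) {X : Set (BR k B)} {N : ℕ}
    (hX : 2 ^ N * ENNReal.ofReal (discr (k := k) d ω) ≤ vol d X) :
    2 ^ N * ENNReal.ofReal |(finBasis ℝ (BR k B)).det P| ≤
      MeasureTheory.volume ((finBasis ℝ (BR k B)).equivFun '' X) := by
  have hpos := rootGram_pos hd (finBasis ℝ (BR k B))
  have h1 : discr (k := k) d ω =
      |(finBasis ℝ (BR k B)).det P| * rootGram d (finBasis ℝ (BR k B)) := by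
    rw [← rootGram_eq_abs_det_mul, discr, ← rootGram_comp_equiv d e]
    congr 1
    funext i
    exact (hP i).symm
  have h2 : {c : Fin (finrank ℝ (BR k B)) → ℝ | (finBasis ℝ (BR k B)).equivFun.symm c ∈ X} =
      (finBasis ℝ (BR k B)).equivFun '' X :=
    ((finBasis ℝ (BR k B)).equivFun.toEquiv.image_eq_preimage_symm X).symm
  rw [vol, h2, h1, ENNReal.ofReal_mul (abs_nonneg _), ← mul_assoc, mul_comm] at hX
  exact (ENNReal.mul_le_mul_iff_right (ENNReal.ofReal_pos.mpr hpos).ne' ENNReal.ofReal_ne_top).mp hX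

end RealBasis

/-! ### The determinant of right multiplication on `B_ℝ`. -/

section Determinant

theorem det_pi_map {R ι : Type*} [CommRing R] [Fintype ι] [DecidableEq ι] {M : ι → Type*}
    [∀ i, AddCommGroup (M i)] [∀ i, Module R (M i)] [∀ i, Module.Free R (M i)]
    [∀ i, Module.Finite R (M i)] (f : ∀ i, M i →ₗ[R] M i) :
    LinearMap.det (LinearMap.pi fun i => (f i).comp (LinearMap.proj i)) =
      ∏ i, LinearMap.det (f i) := by
  classical
  let b := fun i => Module.Free.chooseBasis R (M i)
  -- The matrix is block diagonal; an arbitrary order on the blocks lets it be treated as block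
  -- triangular.
  let _ : LinearOrder ι := linearOrderOfSTO WellOrderingRel
  rw [← LinearMap.det_toMatrix (Pi.basis b)]
  set M' := LinearMap.toMatrix (Pi.basis b) (Pi.basis b)
    (LinearMap.pi fun i => (f i).comp (LinearMap.proj i)) with hM'
  have hentry : ∀ p q, M' p q = (b p.1).repr (f p.1 (Pi.single q.1 (b q.1 q.2) p.1)) p.2 := by
    intro p q
    rw [hM', LinearMap.toMatrix_apply, Pi.basis_repr, Pi.basis_apply]
    rfl
  have htri : M'.BlockTriangular Sigma.fst := fun p q hpq => by
    rw [hentry, Pi.single_eq_of_ne hpq.ne', map_zero, map_zero, Finsupp.zero_apply]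
  rw [htri.det_fintype]
  refine Finset.prod_congr rfl fun i _ => ?_
  rw [← LinearMap.det_toMatrix (b i),
    ← Matrix.det_submatrix_equiv_self (Equiv.sigmaSubtype i).symm]
  congr 1
  ext a c
  rw [Matrix.submatrix_apply, Matrix.toSquareBlock_def, Matrix.of_apply, hentry,
    LinearMap.toMatrix_apply]
  change (b i).repr (f i (Pi.single i (b i c) i)) a = _
  rw [Pi.single_eq_same]

variable {k : Type*} [Field k] [NumberField k] {B : Type*} [DivisionRing B] [Algebra k B]
  [FiniteDimensional k B] [Algebra.IsCentral k B]

theorem abs_det_mulRight_BR {d : ℕ} (hd : finrank k B = d ^ 2) (x : BR k B) :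
    |LinearMap.det (LinearMap.mulRight ℝ x)| = ∏ v, absNormInf v (x v) := by
  classical
  have h : LinearMap.mulRight ℝ x = LinearMap.pi fun v =>
      (LinearMap.mulRight ℝ (x v)).comp (LinearMap.proj v) := rfl
  rw [h, det_pi_map, Finset.abs_prod]
  refine Finset.prod_congr rfl fun v _ => ?_
  have h1 : LinearMap.mulRight ℝ (x v) =
      (LinearMap.mulRight v.Completion (x v)).restrictScalars ℝ := rfl
  rw [h1, LinearMap.det_restrictScalars, abs_norm_completion, det_mulRight_eq_norm hd]
  rfl

end Determinant

end DivAlg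

noncomputable section
namespace DivAlg

/-! ### Minkowski's theorem with an index bound. -/

section Minkowski

open MeasureTheory

/-- Minkowski's convex body theorem for a sublattice of finite index. -/
theorem exists_ne_zero_mem_of_relIndex_mul_le_volume {n : ℕ} [Nonempty (Fin n)]
    (b : Basis (Fin n) ℝ (Fin n → ℝ)) {L : Submodule ℤ (Fin n → ℝ)}
    (hL : L ≤ Submodule.span ℤ (Set.range b))
    (hI : L.toAddSubgroup.relIndex (Submodule.span ℤ (Set.range b)).toAddSubgroup ≠ 0)
    {s : Set (Fin n → ℝ)} (hsymm : ∀ x ∈ s, -x ∈ s) (hconv : Convex ℝ s) (hcpt : IsCompact s)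
    (h : 2 ^ n * ENNReal.ofReal
      (L.toAddSubgroup.relIndex (Submodule.span ℤ (Set.range b)).toAddSubgroup *
        |(Matrix.of b).det|) ≤ volume s) :
    ∃ x ∈ L, x ≠ 0 ∧ x ∈ s := by
  set I := L.toAddSubgroup.relIndex (Submodule.span ℤ (Set.range b)).toAddSubgroup with hIdef
  have hdisc : DiscreteTopology L :=
    DiscreteTopology.of_subset (s := (Submodule.span ℤ (Set.range b) : Set (Fin n → ℝ)))
      (inferInstanceAs (DiscreteTopology (Submodule.span ℤ (Set.range b)))) hL
  have hspan : IsZLattice ℝ L := by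
    refine ⟨?_⟩
    rw [eq_top_iff, ← b.span_eq, Submodule.span_le]
    rintro _ ⟨i, rfl⟩
    -- Finite index puts a positive multiple of each `b i` in `L`, so `L` still spans.
    obtain ⟨m, hm, -, hmb⟩ := AddSubgroup.exists_nsmul_mem_of_relIndex_ne_zero hI
      (Submodule.subset_span ⟨i, rfl⟩ : b i ∈ Submodule.span ℤ (Set.range b))
    have h2 : b i = (m : ℝ)⁻¹ • ((m : ℝ) • b i) := by
      rw [smul_smul, inv_mul_cancel₀ (Nat.cast_ne_zero.mpr hm.ne'), one_smul]
    rw [SetLike.mem_coe, h2, Nat.cast_smul_eq_nsmul]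
    exact Submodule.smul_mem _ _ (Submodule.subset_span hmb.1)
  have hfree := ZLattice.module_free ℝ L
  have hfin := ZLattice.module_finite ℝ L
  have hcount : Countable L := inferInstance
  have hcov := ZLattice.covolume_div_covolume_eq_relIndex L (Submodule.span ℤ (Set.range b)) hL
  rw [div_eq_iff (ZLattice.covolume_ne_zero _ _), ← hIdef,
    ZLattice.covolume_eq_measure_fundamentalDomain _ volume (ZSpan.isAddFundamentalDomain b volume),
    Measure.real, ZSpan.volume_fundamentalDomain, ENNReal.toReal_ofReal (abs_nonneg _)] at hcov
  have hfund := ZLattice.isAddFundamentalDomain (Module.Free.chooseBasis ℤ L) volume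
  rw [ZLattice.covolume_eq_measure_fundamentalDomain _ volume hfund] at hcov
  have hvol : volume (ZSpan.fundamentalDomain
      ((Module.Free.chooseBasis ℤ L).ofZLatticeBasis ℝ L)) =
      ENNReal.ofReal (I * |(Matrix.of b).det|) := by
    rw [← hcov, ofReal_measureReal (ZSpan.fundamentalDomain_isBounded _).measure_lt_top.ne]
  obtain ⟨x, hx0, hx⟩ := exists_ne_zero_mem_lattice_of_measure_mul_two_pow_le_measure
    (L := L.toAddSubgroup) hfund hsymm hconv hcpt (by
      rw [hvol, finrank_fin_fun, mul_comm]
      exact h)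
  exact ⟨x, x.2, fun h0 => hx0 (Subtype.ext h0), hx⟩

end Minkowski

/-! ### An integral multiple of the lattice `D β⁻¹`. -/

section ScaledLattice

variable {k : Type*} [Field k] [NumberField k] {B : Type*} [DivisionRing B] [Algebra k B]
  {D : Subalgebra (𝓞 k) B}

theorem tmul_natCast_smul {v : HeightOneSpectrum (𝓞 k)} (c : ℕ) (y : B) :
    (1 : v.adicCompletion k) ⊗ₜ[k] (c • y) = (c : k) • ((1 : v.adicCompletion k) ⊗ₜ[k] y) := by
  rw [← Nat.cast_smul_eq_nsmul k, one_tmul_smul]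

/-- A positive integer that clears the denominators of finitely many local elements. -/
theorem IsOrder.exists_nat_smul_mem (hD : IsOrder D) (T : Finset (HeightOneSpectrum (𝓞 k)))
    (z : (v : HeightOneSpectrum (𝓞 k)) → AtFin B v) :
    ∃ c : ℕ, c ≠ 0 ∧ ∀ v ∈ T, (c : k) • z v ∈ localOrder D v := by
  obtain ⟨r, hr, hrz⟩ := hD.exists_common_smul_mem T z
  obtain ⟨s, hs⟩ := Ideal.mem_span_singleton'.mp (Ideal.absNorm_mem (Ideal.span {r}))
  refine ⟨Ideal.absNorm (Ideal.span {r}), ?_, fun v hv => ?_⟩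
  · rwa [Ne, Ideal.absNorm_eq_zero_iff, Ideal.span_singleton_eq_bot]
  · have h : ((Ideal.absNorm (Ideal.span {r}) : ℕ) : k) = (s : k) * (r : k) := by
      rw [← coe_int_mul, hs]
      simp
    rw [h, mul_smul]
    exact int_smul_mem_localOrder s (hrz v hv)

theorem prod_absNormInf_natCast [FiniteDimensional k B] (c : ℕ) :
    ∏ w : InfinitePlace k, absNormInf w ((1 : w.Completion) ⊗ₜ[k] ((c : ℕ) : B)) =
      (c : ℝ) ^ (finrank ℚ k * finrank k B) := by
  rw [← InfinitePlace.sum_mult_eq, Finset.sum_mul, ← Finset.prod_pow_eq_pow_sum]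
  refine Finset.prod_congr rfl fun w _ => ?_
  rw [absNormInf_one_tmul, ← map_natCast (algebraMap k B), Algebra.norm_algebraMap, map_pow,
    ← pow_mul, mul_comm, ← InfinitePlace.norm_embedding_eq, map_natCast, Complex.norm_natCast]

/-- For `β` in the unit group of the finite `S`-adeles, the elements `c δ` of the order with `δ β`
integral at `S` and `δ` integral outside of `S` form a subgroup of controlled index. -/
theorem exists_sublattice [Algebra.IsCentral k B] [FiniteDimensional k B] {d : ℕ}
    (hd : finrank k B = d ^ 2) (hD : IsOrder D) {S : Finset (HeightOneSpectrum (𝓞 k))}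
    (β : (v : S) → (AtFin B v.1)ˣ) :
    ∃ (c : ℕ) (L : AddSubgroup B), c ≠ 0 ∧ L ≤ orderAddSubgroup D ∧
      L.relIndex (orderAddSubgroup D) ≠ 0 ∧
      (L.relIndex (orderAddSubgroup D) : ℝ) ≤ (c : ℝ) ^ (finrank ℚ k * finrank k B) *
        ∏ v, absNormFin v.1 (β v : AtFin B v.1) ∧
      ∀ y : B, c • y ∈ L →
        (∀ v : S, (1 : v.1.adicCompletion k) ⊗ₜ[k] y * (β v : AtFin B v.1) ∈ localOrder D v.1) ∧
        ∀ v ∉ S, (1 : v.adicCompletion k) ⊗ₜ[k] y ∈ localOrder D v := by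
  classical
  have : CharZero B := charZero_of_injective_algebraMap (algebraMap k B).injective
  -- The integer `c` makes `α = c β⁻¹` integral everywhere, so that `L`, which stands for `c D β⁻¹`,
  -- can be compared with `D` by an index.
  obtain ⟨c, hc, hcβ⟩ := hD.exists_nat_smul_mem S
    fun v => (((extendOne β v)⁻¹ : (AtFin B v)ˣ) : AtFin B v)
  have hck : (c : k) ≠ 0 := Nat.cast_ne_zero.mpr hc
  let cB : Bˣ := Units.mk0 (c : B) (Nat.cast_ne_zero.mpr hc)
  let α : (v : HeightOneSpectrum (𝓞 k)) → (AtFin B v)ˣ := fun v =>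
    unitsAtFin v cB * (extendOne β v)⁻¹
  have hα : ∀ v, (α v : AtFin B v) =
      (c : k) • (((extendOne β v)⁻¹ : (AtFin B v)ˣ) : AtFin B v) := fun v => by
    rw [smul_eq_one_tmul_mul, map_natCast]
    rfl
  have hcD : (c : B) ∈ D := natCast_mem D c
  have hmem : ∀ v, (α v : AtFin B v) ∈ localOrder D v := fun v => by
    by_cases hv : v ∈ S
    · rw [hα]
      exact hcβ v hv
    · simp only [α, extendOne_of_notMem β hv, inv_one, mul_one]
      exact one_tmul_mem_localOrder v hcD
  have hnormα : ∀ v, (absNormFin v (α v : AtFin B v))⁻¹ =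
      (absNormFin v ((1 : v.adicCompletion k) ⊗ₜ[k] (cB : B)))⁻¹ *
        absNormFin v (extendOne β v : AtFin B v) := fun v => by
    simp only [α]
    rw [Units.val_mul, absNormFin_mul, absNormFin_units_inv, mul_inv, inv_inv]
    rfl
  -- Off `T` the integer `c` is a unit of `D_v`, so membership of `c y` in `D` already gives
  -- integrality of `y` there.
  let T := S ∪ (finite_absNormFin_ne_one (k := k) cB.ne_zero).toFinset
  have hT : ∀ v ∉ T, absNormFin v ((1 : v.adicCompletion k) ⊗ₜ[k] (cB : B)) = 1 := fun v hv => by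
    by_contra hne
    exact hv (Finset.mem_union_right _ ((Set.Finite.mem_toFinset _).mpr hne))
  have hH : ∀ v ∈ T, ((localOrder D v).map (AddMonoidHom.mulRight (α v : AtFin B v))).relIndex
      (localOrder D v) ≠ 0 := fun v _ h => by
    have h1 := relIndex_mulRight hd hD (hmem v)
    rw [h, Nat.cast_zero] at h1
    exact (inv_pos.mpr (absNormFin_units_pos (α v))).ne h1
  have hidx := relIndex_iInf_comap_le
    (fun v => (Algebra.TensorProduct.includeRight : B →ₐ[k] AtFin B v).toRingHom.toAddMonoidHom)
    (fun v => (localOrder D v).map (AddMonoidHom.mulRight (α v : AtFin B v))) (localOrder D)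
    (orderAddSubgroup D) T (fun v _ => map_orderAddSubgroup_le v) hH
  refine ⟨c, (⨅ v : T, ((localOrder D v.1).map
    (AddMonoidHom.mulRight (α v : AtFin B v.1))).comap
      (Algebra.TensorProduct.includeRight : B →ₐ[k] AtFin B v.1).toRingHom.toAddMonoidHom) ⊓
      orderAddSubgroup D, hc, inf_le_right, ?_, ?_, ?_⟩
  · rw [AddSubgroup.inf_relIndex_right]
    exact hidx.1
  · rw [AddSubgroup.inf_relIndex_right]
    refine (Nat.cast_le.mpr hidx.2).trans_eq ?_
    rw [Nat.cast_prod, Finset.prod_congr rfl fun v _ => relIndex_mulRight hd hD (hmem v),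
      Finset.prod_congr rfl fun v _ => hnormα v, Finset.prod_mul_distrib, Finset.prod_inv_distrib]
    have h1 := prod_absNormInf_mul_prod_absNormFin cB.ne_zero hT
    have h2 : ∏ w : InfinitePlace k, absNormInf w ((1 : w.Completion) ⊗ₜ[k] (cB : B)) =
      (c : ℝ) ^ (finrank ℚ k * finrank k B) := prod_absNormInf_natCast c
    rw [h2] at h1
    -- By the product formula the finite norms of `c` contribute `c ^ dim_ℚ B`, the factor by which
    -- scaling a convex body by `c` multiplies its volume.
    rw [← eq_inv_of_mul_eq_one_left h1]
    congr 1
    rw [← Finset.prod_subset Finset.subset_union_left (s₁ := S) fun v _ hv => by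
      rw [extendOne_of_notMem β hv, Units.val_one, absNormFin_one], ← Finset.prod_coe_sort S]
    simp only [extendOne_coe]
  · rintro y ⟨hyL, hyD⟩
    have hkey : ∀ v ∈ T, (1 : v.adicCompletion k) ⊗ₜ[k] y * (extendOne β v : AtFin B v) ∈
        localOrder D v := by
      intro v hv
      obtain ⟨z, hz, hzy⟩ := AddSubgroup.mem_iInf.mp hyL ⟨v, hv⟩
      have h1 : z * (α v : AtFin B v) = (1 : v.adicCompletion k) ⊗ₜ[k] (c • y) := hzy
      rw [tmul_natCast_smul, hα, mul_smul_comm] at h1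
      have h2 : z * (((extendOne β v)⁻¹ : (AtFin B v)ˣ) : AtFin B v) =
          (1 : v.adicCompletion k) ⊗ₜ[k] y := smul_right_injective _ hck h1
      rw [← h2, Units.inv_mul_cancel_right]
      exact hz
    refine ⟨fun v => ?_, fun v hv => ?_⟩
    · have h := hkey v.1 (Finset.mem_union_left _ v.2)
      rwa [extendOne_coe] at h
    · by_cases hvT : v ∈ T
      · have h := hkey v hvT
        rwa [extendOne_of_notMem β hv, Units.val_one, mul_one] at h
      · have h1 := inv_mem_localOrder hD (x := unitsAtFin v cB) (one_tmul_mem_localOrder v hcD)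
          (hT v hvT)
        have h2 := mul_mem_localOrder h1 (one_tmul_mem_localOrder v hyD)
        have h3 : (1 : v.adicCompletion k) ⊗ₜ[k] (c • y) =
            (unitsAtFin v cB : AtFin B v) * ((1 : v.adicCompletion k) ⊗ₜ[k] y) := by
          rw [coe_unitsAtFin, Algebra.TensorProduct.tmul_mul_tmul, mul_one, nsmul_eq_mul]
          rfl
        rwa [h3, Units.inv_mul_cancel_left] at h2

end ScaledLattice

end DivAlg

noncomputable section
namespace DivAlg

/-! ### Moving a point of `G_S` into `F_X`. -/

section Moving

open MeasureTheory

variable {k : Type*} [Field k] [NumberField k] {B : Type*} [DivisionRing B] [Algebra k B]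
  [Algebra.IsCentral k B] [FiniteDimensional k B] {D : Subalgebra (𝓞 k) B}

/-- Right multiplication by a unit of `B_ℝ` as a linear equivalence. -/
def mulRightEquiv (x : (BR k B)ˣ) : BR k B ≃ₗ[ℝ] BR k B where
  __ := LinearMap.mulRight ℝ (x : BR k B)
  invFun := fun y => y * ((x⁻¹ : (BR k B)ˣ) : BR k B)
  left_inv := fun y => Units.mul_inv_cancel_right y x
  right_inv := fun y => Units.inv_mul_cancel_right y x

/-- A sublattice `L` of an order, of index small compared to `c`, has a nonzero point `c δ` with
`δ x` in the given convex body. -/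
theorem exists_mul_mem_of_relIndex_le {d : ℕ} (hd : finrank k B = d ^ 2) (hD : IsOrder D)
    {ι : Type*} [Fintype ι] [DecidableEq ι] (ω : Basis ι ℤ D)
    {X : Set (BR k B)} (hXcompact : IsCompact X) (hXconvex : Convex ℝ X)
    (hXsymm : ∀ x ∈ X, -x ∈ X)
    (hXvol : 2 ^ (finrank ℚ k * finrank k B) * ENNReal.ofReal (discr d ω) ≤ vol d X)
    (x : (BR k B)ˣ) {L : AddSubgroup B} (hL : L ≤ orderAddSubgroup D)
    (hI : L.relIndex (orderAddSubgroup D) ≠ 0) {c : ℕ} (hc : c ≠ 0)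
    (hIc : (L.relIndex (orderAddSubgroup D) : ℝ) * ∏ v, absNormInf v ((x : BR k B) v) ≤
      (c : ℝ) ^ (finrank ℚ k * finrank k B)) :
    ∃ δ : B, δ ≠ 0 ∧ c • δ ∈ L ∧ toBR δ * (x : BR k B) ∈ X := by
  have hd0 : d ≠ 0 := by
    rintro rfl
    exact (finrank_pos (R := k) (M := B)).ne' (by simpa using hd)
  rw [← finrank_BR k B] at hXvol hIc
  let e : Fin (finrank ℝ (BR k B)) ≃ ι :=
    (finCongr (hD.card_eq_finrank ω).symm).trans (Fintype.equivFin ι).symm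
  let P : Basis (Fin (finrank ℝ (BR k B))) ℝ (BR k B) := (hD.realBasis ω).reindex e.symm
  have hP : ∀ i, P i = toBR (ω (e i) : B) := fun i => by
    simp only [P]
    rw [Basis.reindex_apply, Equiv.symm_symm, hD.realBasis_apply]
  have hvol := two_pow_mul_le_volume hd0 hD ω P e hP hXvol
  set f := finBasis ℝ (BR k B) with hf
  -- Minkowski's theorem is applied to `L x` in coordinates. The basis `b` below spans `D x`, whose
  -- covolume is that of `D` times `∏ |Norm_v(x_v)|`.
  let ψ : B →+ (Fin (finrank ℝ (BR k B)) → ℝ) :=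
    ((mulRightEquiv x).trans f.equivFun).toLinearMap.toAddMonoidHom.comp (toBRHom k B)
  have hψ : ∀ y, ψ y = f.equivFun (toBR y * (x : BR k B)) := fun y => rfl
  let b : Basis (Fin (finrank ℝ (BR k B))) ℝ (Fin (finrank ℝ (BR k B)) → ℝ) :=
    P.map ((mulRightEquiv x).trans f.equivFun)
  have hb : ∀ i, b i = ψ (ω (e i)) := fun i => by
    simp only [b]
    rw [Basis.map_apply, hP]
    rfl
  have hdet : |(Matrix.of b).det| = (∏ v, absNormInf v ((x : BR k B) v)) * |f.det P| := by
    rw [← abs_det_mulRight_BR hd, ← abs_mul, ← Basis.det_comp, Basis.det_apply,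
      ← Matrix.det_transpose]
    rfl
  have hspan : (Submodule.span ℤ (Set.range b)).toAddSubgroup = (orderAddSubgroup D).map ψ := by
    let ψD : D →+ (Fin (finrank ℝ (BR k B)) → ℝ) :=
      ψ.comp (Subalgebra.toSubmodule D).subtype.toAddMonoidHom
    have h1 : Set.range b = ψD.toIntLinearMap '' Set.range ω := by
      rw [← Set.range_comp, ← e.surjective.range_comp (ψD.toIntLinearMap ∘ ω)]
      congr 1
      funext i
      exact hb i
    rw [h1, ← Submodule.map_span, ω.span_eq]
    ext z
    constructor
    · rintro ⟨y, -, rfl⟩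
      exact ⟨y, y.2, rfl⟩
    · rintro ⟨y, hy, rfl⟩
      exact ⟨⟨y, hy⟩, trivial, rfl⟩
  have hle : (L.map ψ).relIndex ((orderAddSubgroup D).map ψ) ∣
      L.relIndex (orderAddSubgroup D) := by
    rw [← AddSubgroup.relIndex_comap]
    exact AddSubgroup.relIndex_dvd_of_le_left _ (AddSubgroup.le_comap_map ψ L)
  have hI' : (L.map ψ).relIndex ((orderAddSubgroup D).map ψ) ≠ 0 := ne_zero_of_dvd_ne_zero hI hle
  have hle' := Nat.le_of_dvd (Nat.pos_of_ne_zero hI) hle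
  have hne : Nonempty (Fin (finrank ℝ (BR k B))) := by
    rw [← Fin.pos_iff_nonempty, finrank_BR]
    exact Nat.mul_pos finrank_pos finrank_pos
  let φ : BR k B →L[ℝ] (Fin (finrank ℝ (BR k B)) → ℝ) :=
    LinearMap.toContinuousLinearMap f.equivFun.toLinearMap
  have hφ : ∀ y, φ y = f.equivFun y := fun y => rfl
  have hφX : φ '' X = f.equivFun '' X := rfl
  obtain ⟨z, ⟨y, hyL, hyz⟩, hz0, w, ⟨x', hx', hx'w⟩, hwz⟩ :=
    exists_ne_zero_mem_of_relIndex_mul_le_volume b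
    -- The body is `c X` because `L` consists of multiples `c δ`; dividing the point found by `c`
    -- gives `δ x ∈ X`.
    (L := (L.map ψ).toIntSubmodule) (s := (c : ℝ) • (φ '' X)) (by
      intro z hz
      have : z ∈ (Submodule.span ℤ (Set.range b)).toAddSubgroup := by
        rw [hspan]
        exact AddSubgroup.map_mono hL hz
      exact this)
    (by rw [hspan]; exact hI')
    (by
      rintro _ ⟨_, ⟨y, hy, rfl⟩, rfl⟩
      exact ⟨φ (-y), ⟨-y, hXsymm y hy, rfl⟩, by simp⟩)
    ((hXconvex.linear_image φ.toLinearMap).smul _)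
    ((hXcompact.image φ.continuous).smul _)
    (by
      rw [hspan, hdet, Measure.addHaar_smul, finrank_fin_fun, hφX, ← mul_assoc (Nat.cast _),
        ENNReal.ofReal_mul (mul_nonneg (Nat.cast_nonneg _)
          (Finset.prod_nonneg fun v _ => absNormInf_nonneg _)), mul_left_comm]
      refine mul_le_mul' (ENNReal.ofReal_le_ofReal ?_) hvol
      rw [abs_of_nonneg (by positivity)]
      refine le_trans (mul_le_mul_of_nonneg_right (Nat.cast_le.mpr hle')
        (Finset.prod_nonneg fun v _ => absNormInf_nonneg _)) hIc)
  have hck : (c : k) ≠ 0 := Nat.cast_ne_zero.mpr hc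
  have hcy : c • ((c : k)⁻¹ • y) = y := by
    rw [← Nat.cast_smul_eq_nsmul k, smul_smul, mul_inv_cancel₀ hck, one_smul]
  refine ⟨(c : k)⁻¹ • y, ?_, by rwa [hcy], ?_⟩
  · intro h0
    rw [h0, smul_zero] at hcy
    rw [← hyz, ← hcy] at hz0
    exact hz0 (map_zero ψ)
  · have h1 : f.equivFun (toBR y * (x : BR k B)) = f.equivFun ((c : ℝ) • x') := by
      rw [map_smul, ← hψ, ← hφ, hx'w]
      exact hyz.trans hwz.symm
    have h2 : toBR y * (x : BR k B) = (c : ℝ) • (toBR ((c : k)⁻¹ • y) * (x : BR k B)) := by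
      rw [← smul_mul_assoc, Nat.cast_smul_eq_nsmul]
      congr 1
      rw [← hcy]
      exact (map_nsmul (toBRHom k B) c _).trans (by rw [hcy]; rfl)
    rw [h2] at h1
    rw [smul_right_injective _ (Nat.cast_ne_zero.mpr hc : (c : ℝ) ≠ 0) (f.equivFun.injective h1)]
    exact hx'

end Moving

end DivAlg

theorem proposition4p1
    {k : Type*} [Field k] [NumberField k]
    {B : Type*} [DivisionRing B] [Algebra k B] [Algebra.IsCentral k B] [FiniteDimensional k B]
    (d : ℕ) (hd : finrank k B = d ^ 2)
    (D : Subalgebra (𝓞 k) B) (hD : DivAlg.IsOrder D)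
    {ι : Type*} [Fintype ι] [DecidableEq ι] (ω : Basis ι ℤ D)
    (X : Set (DivAlg.BR k B)) (hXcompact : IsCompact X) (hXconvex : Convex ℝ X)
    (hXsymm : ∀ x ∈ X, -x ∈ X)
    (hXvol : 2 ^ (finrank ℚ k * finrank k B) * ENNReal.ofReal (DivAlg.discr d ω)
      ≤ DivAlg.vol d X)
    (m : ℝ) (hm : 0 ≤ m)
    (hXm : ∀ x ∈ X, ∀ v : InfinitePlace k,
      DivAlg.absNormInf v (x v) ≤ m ^ ((v.mult : ℝ) / (finrank ℚ k : ℝ)))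
    (S : Finset (HeightOneSpectrum (𝓞 k)))
    (hS : ∀ v : HeightOneSpectrum (𝓞 k), (Ideal.absNorm v.asIdeal : ℝ) ^ d ≤ m → v ∈ S) :
    IsCompact (DivAlg.F S D X m) ∧
      (((DivAlg.sUnits S D).map (DivAlg.diag S) : Subgroup (DivAlg.BS B S)) :
          Set (DivAlg.BS B S)) * DivAlg.F S D X m
        = (DivAlg.G B S : Set (DivAlg.BS B S)) := by
  refine ⟨DivAlg.isCompact_F hD hXcompact hm hXm S, Set.Subset.antisymm ?_ ?_⟩
  · rintro _ ⟨_, ⟨γ, hγ, rfl⟩, f, hf, rfl⟩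
    exact mul_mem (DivAlg.diag_mem_G hD hγ) hf.1
  · intro g hg
    let x : (DivAlg.BR k B)ˣ := MulEquiv.piUnits.symm g.1
    obtain ⟨c, L, hc, hL, hI, hIle, hLmem⟩ := DivAlg.exists_sublattice hd hD g.2
    have hpos : 0 < ∏ v, DivAlg.absNormFin v.1 (g.2 v : DivAlg.AtFin B v.1) :=
      Finset.prod_pos fun v _ => DivAlg.absNormFin_units_pos _
    have hgx : ∏ v, DivAlg.absNormInf v ((x : DivAlg.BR k B) v) =
        (∏ v, DivAlg.absNormFin v.1 (g.2 v : DivAlg.AtFin B v.1))⁻¹ := hg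
    -- The equation of `G_S` cancels the norms of `β` in the index of `L` against those of `x`,
    -- leaving exactly the factor absorbed by scaling `X` by `c`.
    obtain ⟨δ, hδ0, hδL, hδX⟩ := DivAlg.exists_mul_mem_of_relIndex_le hd hD ω hXcompact hXconvex
      hXsymm hXvol x hL hI hc (by
        rw [hgx, ← div_eq_mul_inv, div_le_iff₀ hpos]
        exact hIle)
    obtain ⟨hδS, hδS'⟩ := hLmem δ hδL
    have hδ : Units.mk0 δ hδ0 ∈ DivAlg.sUnits S D :=
      DivAlg.mem_sUnits_of_diag_mul_mem hd hD hm hS hg (fun v => hXm _ hδX v) hδS hδS'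
    refine ⟨DivAlg.diag S (Units.mk0 δ hδ0)⁻¹, ⟨_, inv_mem hδ, rfl⟩,
      DivAlg.diag S (Units.mk0 δ hδ0) * g, ?_, ?_⟩
    · exact (DivAlg.mem_F_iff hD hm hXm).mpr
        ⟨mul_mem (DivAlg.diag_mem_G hD hδ) hg, hδX, hδS⟩
    · change DivAlg.diag S (Units.mk0 δ hδ0)⁻¹ * (DivAlg.diag S (Units.mk0 δ hδ0) * g) = g
      rw [map_inv, inv_mul_cancel_left]
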